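/- Let $m\in[2,\infty)$, $\nu\le 0$ and $q\in(2,\infty]$ satisfy $\frac{\nu}{2}-\frac1q>-\frac12$ (with $\frac1\infty=0$). There is a constant $C\ge0$ depending only on $(m,\nu,q)$ such that the following holds. Let $T>0$ and $d\in\mathbb N$, and let $(\Omega,\mathcal F,\mathbb P)$ be a complete probability space with a filtration $\{\mathcal F_t\}_{t\ge0}$ such that $\mathcal F_0$ contains all $\mathbb P$-null sets. Write $L_m=L^m(\Omega,\mathcal F,\mathbb P)$ and $\mathbb E^{\mathcal F_s}$ for the conditional expectation given $\mathcal F_s$. Let $X=\{X_t\}_{t\ge0}$ be a Markov process in $\mathbb R^d$ with respect to $\{\mathcal F_t\}$ with Lebesgue-measurable sample paths. Let $(\mathcal H,\|\cdot\|_{\mathcal H})$ be a real normed vector space of (real) tempered distributions on $\mathbb R^d$ which contains all bounded continuous functions $\mathbb R^d\to\mathbb R$, and let $U=\{U_{s,t}\}_{0\le s\le t}$ be a family of bounded linear operators on $\mathcal H$. Let $\|U\|_{\mathcal H,\nu}\ge0$ be a finite number, and assume: (i) for every $h\in\mathcal H$ and $0\le s<t\le T$, $U_{s,t}h$ is a bounded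 continuous function on $\mathbb R^d$ and $\|U_{s,t}h\|_\infty\le\|U\|_{\mathcal H,\nu}\|h\|_{\mathcal H}|t-s|^{\nu/2}$; (ii) for every $s\ge0$, $x\in\mathbb R^d$ and $h\in\mathcal H$, the map $r\mapsto U_{s,r}h(x)$ is Lebesgue measurable on $[s,T]$; (iii) for every $0\le s\le r<t\le T$ and $h\in\mathcal H$, $\mathbb E^{\mathcal F_s}\big[U_{r,t}h(X_r)\big]=U_{s,t}h(X_s)$ a.s. Let $L^q_T\mathcal H=L^q([0,T];\mathcal H)$ be the Bochner space of (classes of) strongly measurable functions, and for $\tau\in(0,1]$ let $C^\tau_TL_m$ be the space of real-valued processes $\psi$ on $[0,T]$ (up to modification) with $\sup_{t}\|\psi_t\|_{L_m}+\sup_{s\ne t}\|\psi_t-\psi_s\|_{L_m}/|t-s|^{\tau}<\infty$. Then for every $f\in L^q_T\mathcal H$, $0\le s\le t\le T$ and $x\in\mathbb R^d$ the map $r\mapsto U_{s,r}f_r(x)$ is integrable on $[s,t]$, the random variable $\int_{[s,t]}U_{s,r}f_r(X_s)\,dr$ belongs to $L_m$, and there exists a linear map $\mathcal A^X$ from $L^q_T\mathcal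 H$ to $C_T^{1+\frac\nu2-\frac1q}L_m$ with the following properties. (a) For every $f\in L^q_T\mathcal H$ and every $0\le s\le t\le T$, $\mathcal A^X_t[f]$ is $\mathcal F_t$-measurable, $$\mathbb E^{\mathcal F_s}\big(\mathcal A^X_t[f]-\mathcal A^X_s[f]\big)=\int_{[s,t]}U_{s,r}f_r(X_s)\,dr\quad\text{a.s.}$$ and $$\big\|\mathcal A^X_t[f]-\mathcal A^X_s[f]\big\|_{L_m}\le C\,\|U\|_{\mathcal H,\nu}\,\|f\mathbf 1_{[s,t]}\|_{L^q_T\mathcal H}\,|t-s|^{1+\frac\nu2-\frac1q}.$$ (b) For every $f\in L^q_T\mathcal H$ and every $t\in[0,T]$, $\mathcal A^X_t[f]$ is the limit in $L_m$ of the Riemann sums $$\sum_i\int_{[t_i,t_{i+1}]}U_{t_i,r}f_r(X_{t_i})\,dr$$ over finite partitions $\{t_i\}_i$ of $[0,t]$, as $\max_i|t_{i+1}-t_i|\to0$. -/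

import Mathlib

open MeasureTheory ProbabilityTheory Set
open scoped ENNReal SchwartzMap BoundedContinuousFunction

/-- The state space `ℝ^d` with its Euclidean norm. -/
abbrev Rd (d : ℕ) : Type := EuclideanSpace ℝ (Fin d)

/-- Real tempered distributions on `ℝ^d`: continuous linear functionals on the real Schwartz
space. -/
abbrev RealTemperedDistribution (d : ℕ) : Type := 𝓢(Rd d, ℝ) →L[ℝ] ℝ

/-- The distribution `u` *is* the bounded continuous function `g`: it acts on Schwartz functions by
integration against `g`. -/
def IsFunction {d : ℕ} (u : RealTemperedDistribution d) (g : Rd d →ᵇ ℝ) : Prop :=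
  ∀ φ : 𝓢(Rd d, ℝ), u φ = ∫ x, φ x * g x

open Classical in
/-- The value `u(x)` of a tempered distribution which is a bounded continuous function
(and `0` if `u` is not a bounded continuous function). -/
noncomputable def valueAt {d : ℕ} (u : RealTemperedDistribution d) (x : Rd d) : ℝ :=
  if h : ∃ g : Rd d →ᵇ ℝ, IsFunction u g then h.choose x else 0

/-- A distribution is at most one bounded continuous function. -/
theorem IsFunction.unique {d : ℕ} {u : RealTemperedDistribution d} {g g' : Rd d →ᵇ ℝ}
    (h : IsFunction u g) (h' : IsFunction u g') : g = g' := by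
  have key : (g : Rd d → ℝ) =ᵐ[volume] g' := by
    refine ae_eq_of_integral_contDiff_smul_eq g.continuous.locallyIntegrable
      g'.continuous.locallyIntegrable ?_
    intro φ hφ hc
    have h1 := h (hc.toSchwartzMap hφ)
    have h2 := h' (hc.toSchwartzMap hφ)
    rw [h1] at h2
    simpa using h2
  exact DFunLike.coe_injective
    ((Continuous.ae_eq_iff_eq volume g.continuous g'.continuous).1 key)

/-- `valueAt` is the evaluation of the bounded continuous function. -/
theorem IsFunction.valueAt_eq {d : ℕ} {u : RealTemperedDistribution d} {g : Rd d →ᵇ ℝ}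
    (h : IsFunction u g) (x : Rd d) : valueAt u x = g x := by
  have hex : ∃ g : Rd d →ᵇ ℝ, IsFunction u g := ⟨g, h⟩
  have : hex.choose = g := IsFunction.unique hex.choose_spec h
  unfold valueAt
  rw [dif_pos hex, this]

/-- `ι` realizes the normed space `H` as a space of tempered distributions on `ℝ^d` which contains
all bounded continuous functions. -/
structure IsDistributionSpace {d : ℕ} {H : Type*} [NormedAddCommGroup H] [NormedSpace ℝ H]
    (ι : H →ₗ[ℝ] RealTemperedDistribution d) : Prop where
  injective : Function.Injective ι
  contains_bounded_continuous : ∀ g : Rd d →ᵇ ℝ, ∃ h : H, IsFunction (ι h) g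

/-- `X = (X_t)_{t ≥ 0}` is a Markov process in `ℝ^d` with respect to the filtration
`(F_t)_{t ≥ 0}`, with Lebesgue-measurable sample paths. (Indices are real, but only times `≥ 0` are
used.) -/
structure IsMarkovProcess {d : ℕ} {Ω : Type*} {mΩ : MeasurableSpace Ω} (P : Measure Ω)
    (F : Filtration ℝ mΩ) (X : ℝ → Ω → Rd d) : Prop where
  adapted : ∀ t, 0 ≤ t → Measurable[F t] (X t)
  measurable_paths : ∀ ω, NullMeasurable (fun t => X t ω) (volume.restrict (Ici (0 : ℝ)))
  markov : ∀ s t, 0 ≤ s → s ≤ t → ∀ g : Rd d → ℝ, Measurable g → (∃ B, ∀ x, |g x| ≤ B) →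
    P[fun ω => g (X t ω) | F s] =ᵐ[P]
      P[fun ω => g (X t ω) | MeasurableSpace.comap (X s) inferInstance]

/-- The standing condition on `(X, U, H)` up to time `T`: smoothing of order `ν` with constant `K`
(the number `‖U‖_{H,ν}`), measurability in time, and compatibility of the family `U` with the
transitions of `X`. -/
structure SmoothingCondition {d : ℕ} {Ω : Type*} {mΩ : MeasurableSpace Ω} (P : Measure Ω)
    (F : Filtration ℝ mΩ) (X : ℝ → Ω → Rd d) (T : ℝ)
    {H : Type*} [NormedAddCommGroup H] [NormedSpace ℝ H]
    (ι : H →ₗ[ℝ] RealTemperedDistribution d) (U : ℝ → ℝ → H →L[ℝ] H) (K ν : ℝ) : Prop where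
  smoothing : ∀ (h : H) (s t : ℝ), 0 ≤ s → s < t → t ≤ T →
    ∃ g : Rd d →ᵇ ℝ, IsFunction (ι (U s t h)) g ∧ ‖g‖ ≤ K * ‖h‖ * |t - s| ^ (ν / 2)
  measurable_time : ∀ (s : ℝ) (x : Rd d) (h : H), 0 ≤ s →
    NullMeasurable (fun r => valueAt (ι (U s r h)) x) (volume.restrict (Icc s T))
  transition : ∀ (s r t : ℝ) (h : H), 0 ≤ s → s ≤ r → r < t → t ≤ T →
    P[fun ω => valueAt (ι (U r t h)) (X r ω) | F s] =ᵐ[P]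
      fun ω => valueAt (ι (U s t h)) (X s ω)

/-- The Bochner space `L^q([0,T]; H)`. -/
abbrev BochnerLp (H : Type*) [NormedAddCommGroup H] (q : ℝ≥0∞) (T : ℝ) : Type _ :=
  Lp H q (volume.restrict (Icc (0 : ℝ) T))

/-- The norm `‖f 1_{[s,t]}‖` in `L^q([0,T]; H)`. -/
noncomputable def localNorm {H : Type*} [NormedAddCommGroup H] {q : ℝ≥0∞} {T : ℝ}
    (f : BochnerLp H q T) (s t : ℝ) : ℝ :=
  (eLpNorm ((Icc s t).indicator f) q (volume.restrict (Icc (0 : ℝ) T))).toReal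

/-- The random variable `∫_{[s,t]} U_{s,r} f_r (X_s) dr`. -/
noncomputable def germ {d : ℕ} {Ω : Type*} (X : ℝ → Ω → Rd d)
    {H : Type*} [NormedAddCommGroup H] [NormedSpace ℝ H]
    (ι : H →ₗ[ℝ] RealTemperedDistribution d) (U : ℝ → ℝ → H →L[ℝ] H) {q : ℝ≥0∞} {T : ℝ}
    (f : BochnerLp H q T) (s t : ℝ) (ω : Ω) : ℝ :=
  ∫ r in Icc s t, valueAt (ι (U s r (f r))) (X s ω)

/-- The Hölder space `C^τ([0,T]; L^m(Ω))` of real processes `ψ` for which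
`sup_t ‖ψ_t‖_{L_m} + sup_{s ≠ t} ‖ψ_t - ψ_s‖_{L_m} / |t - s|^τ` is finite. -/
def holderSpace {Ω : Type*} {mΩ : MeasurableSpace Ω} (P : Measure Ω) (m : ℝ≥0∞) [Fact (1 ≤ m)]
    (T τ : ℝ) : Submodule ℝ (Icc (0 : ℝ) T → Lp ℝ m P) where
  carrier := {ψ | (∃ B : ℝ, ∀ t, ‖ψ t‖ ≤ B) ∧
    ∃ B : ℝ, ∀ s t, s ≠ t → ‖ψ t - ψ s‖ / |(t : ℝ) - s| ^ τ ≤ B}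
  zero_mem' := ⟨⟨0, by simp⟩, ⟨0, by simp⟩⟩
  add_mem' := by
    rintro ψ χ ⟨⟨B, hB⟩, ⟨C, hC⟩⟩ ⟨⟨B', hB'⟩, ⟨C', hC'⟩⟩
    refine ⟨⟨B + B', fun t => (norm_add_le _ _).trans (add_le_add (hB t) (hB' t))⟩,
      ⟨C + C', fun s t hst => ?_⟩⟩
    have h : ‖(ψ + χ) t - (ψ + χ) s‖ ≤ ‖ψ t - ψ s‖ + ‖χ t - χ s‖ := by
      have e : (ψ + χ) t - (ψ + χ) s = (ψ t - ψ s) + (χ t - χ s) := by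
        simp only [Pi.add_apply]; abel
      rw [e]; exact norm_add_le _ _
    calc ‖(ψ + χ) t - (ψ + χ) s‖ / |(t : ℝ) - s| ^ τ
        ≤ (‖ψ t - ψ s‖ + ‖χ t - χ s‖) / |(t : ℝ) - s| ^ τ := by gcongr
      _ = ‖ψ t - ψ s‖ / |(t : ℝ) - s| ^ τ + ‖χ t - χ s‖ / |(t : ℝ) - s| ^ τ := add_div _ _ _
      _ ≤ C + C' := add_le_add (hC s t hst) (hC' s t hst)
  smul_mem' := by
    rintro c ψ ⟨⟨B, hB⟩, ⟨C, hC⟩⟩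
    refine ⟨⟨|c| * B, fun t => ?_⟩, ⟨|c| * C, fun s t hst => ?_⟩⟩
    · rw [Pi.smul_apply, norm_smul, Real.norm_eq_abs]
      exact mul_le_mul_of_nonneg_left (hB t) (abs_nonneg c)
    · rw [Pi.smul_apply, Pi.smul_apply, ← smul_sub, norm_smul, Real.norm_eq_abs, mul_div_assoc]
      exact mul_le_mul_of_nonneg_left (hC s t hst) (abs_nonneg c)

/-! The functional is obtained by stochastic sewing of the germ `a(s,t) = ∫_{[s,t]} U_{s,r} f_r
(X_s) dr`. Smoothing, together with Hölder's inequality in time against the weight `|r - s|^{ν/2}`,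
bounds the germ by `K Γ ‖f 1_{[s,t]}‖ (t - s)^γ` with `γ = 1 + ν/2 - 1/q > 1/2`. By Fubini and the
transition identity, the defect `a(s,t) - a(s,u) - a(u,t)` has conditional expectation zero given
`F_s` (`setIntegral_germ_defect`).

Refining a partition therefore changes the Riemann sum by a sum of martingale differences. For `m ≥
2` one has `‖f + g‖² ≤ ‖f‖² + c‖g‖²` in `L^m` whenever `f` is `G`-measurable and `g` is centred
given `G` (`exists_norm_add_sq_le`): expand `|f + g|^m` to second order; the linear term integrates
to zero. Squared norms of martingale differences thus add up to a constant, and a sum of differences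
of size `W h^γ` is at most a multiple of `W √length · mesh^{γ - 1/2}` (`norm_sum_le`), which
vanishes with the mesh.

The sewing takes place in a Banach space with adapted subspaces `V t` and centred subspaces `N t`,
and uses two families of partitions. The traces on `[u,v]` of one dyadic grid of `[0,T]` give limits
additive in the interval, but a remainder with a worse exponent, still above `1/2` (`exists_path`).
The dyadic partitions of `[u,v]` itself give the sharp remainder with the norm of `f` localised to
`[u,v]` (`exists_tendsto_riemannSum_uniform`). Since a path with centred remainders of order above
`1/2` is the limit of its Riemann sums, both limits coincide (`exists_sewing`). The same principle
yields linearity in `f` and convergence along arbitrary partitions. -/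

/-! ### Elementary inequalities for real powers -/

/-- A second order upper bound complementing Bernoulli's inequality. -/
theorem one_add_rpow_le {p y : ℝ} (hp : 1 ≤ p) (hy : |y| * (2 * p) ≤ 1) :
    (1 + y) ^ p ≤ 1 + p * y + 2 * p * (p - 1) * y ^ 2 := by
  have hyp : p * |y| ≤ 1 / 2 := by linarith
  have hy1 : |y| ≤ 1 / 2 := le_trans (le_mul_of_one_le_left (abs_nonneg y) hp) hyp
  obtain ⟨hl, hu⟩ := abs_le.1 hy1
  have hpos : 0 < 1 + y := by linarith
  -- Bernoulli at `-y / (1 + y)`, where `1 + s = (1 + y)⁻¹`, bounds the reciprocal of `(1 + y) ^ p`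
  -- from below, hence the power itself from above.
  have hB := one_add_mul_self_le_rpow_one_add (s := -y / (1 + y)) (p := p)
    (by rw [le_div_iff₀ hpos]; linarith) hp
  have e : 1 + -y / (1 + y) = (1 + y)⁻¹ := by field_simp; ring
  rw [e, Real.inv_rpow hpos.le] at hB
  have hR : 0 < (1 + y) ^ p := Real.rpow_pos_of_pos hpos p
  set R := (1 + y) ^ p
  have e2 : 1 + p * (-y / (1 + y)) = (1 - (p - 1) * y) / (1 + y) := by field_simp; ring
  rw [e2, div_le_iff₀ hpos, inv_mul_eq_div, le_div_iff₀ hR] at hB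
  have hpy : (p - 1) * y ≤ 1 / 2 := by
    calc (p - 1) * y ≤ (p - 1) * |y| := mul_le_mul_of_nonneg_left (le_abs_self y) (by linarith)
      _ ≤ p * |y| := mul_le_mul_of_nonneg_right (by linarith) (abs_nonneg y)
      _ ≤ 1 / 2 := hyp
  have hd : 0 < 1 - (p - 1) * y := by linarith
  refine le_of_mul_le_mul_left (hB.trans ?_) hd
  have h0 : 0 ≤ p * (p - 1) * y ^ 2 :=
    mul_nonneg (mul_nonneg (by linarith) (by linarith)) (sq_nonneg y)
  nlinarith [mul_nonneg h0 (by linarith : 0 ≤ 1 / 2 - (p - 1) * y)]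

theorem abs_rpow_eq_mul_sq {p : ℝ} (hp : 2 ≤ p) (x : ℝ) : |x| ^ p = |x| ^ (p - 2) * x ^ 2 := by
  rcases eq_or_ne x 0 with rfl | hx
  · simp [Real.zero_rpow (by linarith : p ≠ 0)]
  · rw [← sq_abs x, ← Real.rpow_natCast, ← Real.rpow_add (abs_pos.2 hx)]
    norm_num

/-- Taylor's inequality for `|x| ^ p`, globally on the line. -/
theorem exists_abs_add_rpow_le {p : ℝ} (hp : 2 ≤ p) :
    ∃ C : ℝ, 0 ≤ C ∧ ∀ x y : ℝ, |x + y| ^ p ≤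
      |x| ^ p + p * (|x| ^ (p - 2) * x * y) + C * (|x| ^ (p - 2) * y ^ 2 + |y| ^ p) := by
  have hC1 : 0 ≤ 2 * p * (p - 1) := mul_nonneg (by linarith) (by linarith)
  have hC2 : 0 ≤ (2 * p + 1) ^ p := by positivity
  have hC3 : 0 ≤ p * ((2 * p) ^ (p - 2) * (2 * p)) := by positivity
  refine ⟨2 * p * (p - 1) + (2 * p + 1) ^ p + p * ((2 * p) ^ (p - 2) * (2 * p)),
    by linarith, fun x y => ?_⟩
  have hX : 0 ≤ |x| ^ (p - 2) * y ^ 2 := by positivity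
  have hY : 0 ≤ |y| ^ p := by positivity
  -- For small `y / x`, factor out `|x| ^ p` and use the local expansion. Otherwise `|x| ≤ 2 p |y|`,
  -- and both the left side and the possibly negative linear term are controlled by `|y| ^ p`.
  by_cases h : |y| * (2 * p) ≤ |x|
  · rcases eq_or_ne x 0 with rfl | hx
    · have hy : y = 0 := by
        have : |y| ≤ 0 := by
          rw [abs_zero] at h
          nlinarith [abs_nonneg y]
        simpa using this
      subst hy
      simp [Real.zero_rpow (by linarith : p ≠ 0)]
    · have hax : 0 < |x| := abs_pos.2 hx
      have hyx : |y / x| * (2 * p) ≤ 1 := by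
        rw [abs_div, div_mul_eq_mul_div, div_le_one hax]; exact h
      have hb := one_add_rpow_le (by linarith : 1 ≤ p) hyx
      have hpos : 0 ≤ 1 + y / x := by
        have : |y / x| ≤ 1 := by nlinarith [abs_nonneg (y / x)]
        linarith [(abs_le.1 this).1]
      have e : |x + y| ^ p = |x| ^ p * (1 + y / x) ^ p := by
        rw [← Real.mul_rpow hax.le hpos, ← abs_of_nonneg hpos, ← abs_mul]
        congr 2
        field_simp
      rw [e]
      calc |x| ^ p * (1 + y / x) ^ p
          ≤ |x| ^ p * (1 + p * (y / x) + 2 * p * (p - 1) * (y / x) ^ 2) := by gcongr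
        _ = |x| ^ p + p * (|x| ^ (p - 2) * x * y) + 2 * p * (p - 1) * (|x| ^ (p - 2) * y ^ 2) := by
            rw [abs_rpow_eq_mul_sq hp x]; field_simp
        _ ≤ _ := by nlinarith [mul_nonneg hC2 hX, mul_nonneg hC3 hX, mul_nonneg hC1 hY,
            mul_nonneg hC2 hY, mul_nonneg hC3 hY]
  · push Not at h
    have h' : |x| ≤ 2 * p * |y| := by linarith
    have h1 : |x + y| ^ p ≤ (2 * p + 1) ^ p * |y| ^ p := by
      rw [← Real.mul_rpow (by linarith) (abs_nonneg y)]
      refine Real.rpow_le_rpow (abs_nonneg _) ((abs_add_le x y).trans ?_) (by linarith)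
      linarith
    have h2 : -(|x| ^ (p - 2) * x * y) ≤ (2 * p) ^ (p - 2) * (2 * p) * |y| ^ p := by
      calc -(|x| ^ (p - 2) * x * y) ≤ |(|x| ^ (p - 2) * x * y)| := neg_le_abs _
        _ = |x| ^ (p - 2) * |x| * |y| := by
            rw [abs_mul, abs_mul, abs_of_nonneg (by positivity : 0 ≤ |x| ^ (p - 2))]
        _ ≤ (2 * p * |y|) ^ (p - 2) * (2 * p * |y|) * |y| := by
            gcongr
        _ = (2 * p) ^ (p - 2) * (2 * p) * |y| ^ p := by
            rw [abs_rpow_eq_mul_sq hp y, Real.mul_rpow (by linarith) (abs_nonneg y), ← sq_abs y]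
            ring
    have h3 := mul_le_mul_of_nonneg_left h2 (by linarith : 0 ≤ p)
    have h0 : 0 ≤ |x| ^ p := by positivity
    nlinarith [mul_nonneg hC1 hX, mul_nonneg hC2 hX, mul_nonneg hC3 hX, mul_nonneg hC1 hY]

/-- Used with `a = ‖f‖²`, `δ = ‖g‖²`, `r = m/2`, to absorb the Taylor error into the base of the
power. Write each power as `x * x ^ (r - 1)`: both `a` and `δ` are at most the new base, the latter
thanks to the `+ 1` in `2 * C + 1`. -/
theorem rpow_add_ge {a δ C r : ℝ} (ha : 0 ≤ a) (hδ : 0 ≤ δ) (hC : 0 ≤ C) (hr : 1 ≤ r) :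
    a ^ r + C * (a ^ (r - 1) * δ + δ ^ r) ≤ (a + (2 * C + 1) * δ) ^ r := by
  have key : ∀ x : ℝ, 0 ≤ x → x ^ r = x * x ^ (r - 1) := fun x hx => by
    rcases hx.eq_or_lt with rfl | hx
    · simp [Real.zero_rpow (by linarith : r ≠ 0)]
    · nth_rewrite 2 [← Real.rpow_one x]
      rw [← Real.rpow_add hx]; congr 1; ring
  have hc : 0 ≤ (2 * C + 1) * δ := by positivity
  set B := (2 * C + 1) * δ with hB
  have h1 : a ^ (r - 1) ≤ (a + B) ^ (r - 1) :=
    Real.rpow_le_rpow ha (by linarith) (by linarith)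
  have h2 : δ ^ (r - 1) ≤ (a + B) ^ (r - 1) :=
    Real.rpow_le_rpow hδ (by nlinarith) (by linarith)
  rw [key a ha, key (a + B) (by linarith), key δ hδ]
  set Z := (a + B) ^ (r - 1)
  have hZ : 0 ≤ Z := le_trans (by positivity) h1
  have := mul_le_mul_of_nonneg_left h1 ha
  have := mul_le_mul_of_nonneg_left h1 (mul_nonneg hC hδ)
  have := mul_le_mul_of_nonneg_left h2 (mul_nonneg hC hδ)
  have := mul_nonneg hδ hZ
  nlinarith

/-! ### Centred elements and moments in `L^m` -/

section Lp

variable {Ω : Type*} {mΩ : MeasurableSpace Ω} {P : Measure Ω} [IsProbabilityMeasure P]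
  {m : ℝ≥0∞} [Fact (1 ≤ m)]

theorem integrable_coe_Lp (f : Lp ℝ m P) : Integrable f P :=
  (Lp.memLp f).integrable Fact.out

theorem norm_integral_le_norm_Lp (f : Lp ℝ m P) (B : Set Ω) : ‖∫ ω in B, f ω ∂P‖ ≤ ‖f‖ := by
  refine (norm_integral_le_integral_norm _).trans ?_
  refine (setIntegral_le_integral (integrable_coe_Lp f).norm
    (Filter.Eventually.of_forall fun _ => norm_nonneg _)).trans ?_
  rw [integral_norm_eq_lintegral_enorm (Lp.aestronglyMeasurable f), Lp.norm_def,
    ← eLpNorm_one_eq_lintegral_enorm]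
  exact ENNReal.toReal_mono (Lp.eLpNorm_ne_top f)
    (eLpNorm_le_eLpNorm_of_exponent_le Fact.out (Lp.aestronglyMeasurable f))

variable (P m) in
/-- The elements of `L^m` whose conditional expectation given `G` vanishes. -/
noncomputable def condNull (G : MeasurableSpace Ω) : Submodule ℝ (Lp ℝ m P) where
  -- Set integrals are continuous linear functionals, so this form makes the subspace visibly
  -- closed.
  carrier := {f | ∀ B, MeasurableSet[G] B → ∫ ω in B, f ω ∂P = 0}
  zero_mem' := fun B _ => by
    rw [integral_congr_ae (ae_restrict_of_ae (Lp.coeFn_zero ℝ m P))]; simp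
  add_mem' := fun {f g} hf hg B hB => by
    rw [integral_congr_ae (ae_restrict_of_ae (Lp.coeFn_add f g))]
    simp only [Pi.add_apply]
    rw [integral_add (integrable_coe_Lp f).integrableOn (integrable_coe_Lp g).integrableOn,
      hf B hB, hg B hB, add_zero]
  smul_mem' := fun c f hf B hB => by
    rw [integral_congr_ae (ae_restrict_of_ae (Lp.coeFn_smul c f))]
    simp only [Pi.smul_apply]
    rw [integral_smul, hf B hB, smul_zero]

/-- An intersection of zero sets of the functionals `f ↦ ∫_B f`, which are 1-Lipschitz on `L^m`
because `P` is a probability measure. -/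
theorem isClosed_condNull (G : MeasurableSpace Ω) : IsClosed (condNull P m G : Set (Lp ℝ m P)) := by
  have : (condNull P m G : Set (Lp ℝ m P)) =
      ⋂ (B : Set Ω) (_ : MeasurableSet[G] B), {f | ∫ ω in B, f ω ∂P = 0} := by
    ext f; simp [condNull]
  rw [this]
  refine isClosed_iInter fun B => isClosed_iInter fun _ => isClosed_eq ?_ continuous_const
  refine (LipschitzWith.of_dist_le_mul (K := 1) fun f g => ?_).continuous
  have h := norm_integral_le_norm_Lp (f - g) B
  rw [integral_congr_ae (ae_restrict_of_ae (Lp.coeFn_sub f g))] at h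
  simp only [Pi.sub_apply] at h
  rw [integral_sub (integrable_coe_Lp f).integrableOn (integrable_coe_Lp g).integrableOn] at h
  simpa [dist_eq_norm] using h

theorem condNull_anti {G G' : MeasurableSpace Ω} (h : G ≤ G') :
    condNull P m G' ≤ condNull P m G := fun _ hf B hB => hf B (h B hB)

theorem condExp_eq_zero_of_mem_condNull {G : MeasurableSpace Ω} (hG : G ≤ mΩ) {f : Lp ℝ m P}
    (hf : f ∈ condNull P m G) : P[f | G] =ᵐ[P] 0 := by
  refine (ae_eq_condExp_of_forall_setIntegral_eq hG (integrable_coe_Lp f) (g := 0)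
    (fun _ _ _ => integrableOn_zero) (fun B hB _ => ?_) ?_).symm
  · simp [hf B hB]
  · exact stronglyMeasurable_zero.aestronglyMeasurable

omit [IsProbabilityMeasure P] in
theorem norm_rpow_eq_integral (hm : m ≠ ∞) (f : Lp ℝ m P) :
    ‖f‖ ^ m.toReal = ∫ ω, |f ω| ^ m.toReal ∂P := by
  have hm1 : (1 : ℝ≥0∞) ≤ m := Fact.out
  have hm0 : m ≠ 0 := (zero_lt_one.trans_le hm1).ne'
  have hpos : m.toReal ≠ 0 := ENNReal.toReal_ne_zero.2 ⟨hm0, hm⟩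
  have hi : 0 ≤ ∫ ω, |f ω| ^ m.toReal ∂P := integral_nonneg fun _ => by positivity
  rw [Lp.norm_def, (Lp.memLp f).eLpNorm_eq_integral_rpow_norm hm0 hm,
    ENNReal.toReal_ofReal (Real.rpow_nonneg (by simpa using hi) _), Real.rpow_inv_rpow (by simpa using hi) hpos]
  rfl

omit [IsProbabilityMeasure P] in
theorem integrable_abs_rpow (hm : m ≠ ∞) (f : Lp ℝ m P) :
    Integrable (fun ω => |f ω| ^ m.toReal) P := by
  have hm1 : (1 : ℝ≥0∞) ≤ m := Fact.out
  exact (Lp.memLp f).integrable_norm_rpow (zero_lt_one.trans_le hm1).ne' hm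

omit [IsProbabilityMeasure P] in
/-- Hölder's inequality for the second order Taylor term. -/
theorem integral_abs_rpow_mul_sq_le (hm : m ≠ ∞) (hm2 : 2 ≤ m) (f g : Lp ℝ m P) :
    Integrable (fun ω => |f ω| ^ (m.toReal - 2) * g ω ^ 2) P ∧
      ∫ ω, |f ω| ^ (m.toReal - 2) * g ω ^ 2 ∂P ≤ ‖f‖ ^ (m.toReal - 2) * ‖g‖ ^ 2 := by
  have hp : 2 ≤ m.toReal := by
    simpa using ENNReal.toReal_mono hm hm2
  set p := m.toReal with hpdef
  have hp0 : 0 < p := by linarith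
  -- The exponents `(p - 2) / p` and `2 / p` add up to one. Working with `lintegral` gives
  -- integrability and the bound at once.
  have e : ∀ ω, ENNReal.ofReal (|f ω| ^ (p - 2) * g ω ^ 2) =
      ENNReal.ofReal (|f ω| ^ p) ^ ((p - 2) / p) * ENNReal.ofReal (|g ω| ^ p) ^ (2 / p) := by
    intro ω
    rw [ENNReal.ofReal_rpow_of_nonneg (by positivity) (div_nonneg (by linarith) hp0.le),
      ENNReal.ofReal_rpow_of_nonneg (by positivity) (by positivity),
      ← ENNReal.ofReal_mul (by positivity), ← Real.rpow_mul (abs_nonneg _),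
      ← Real.rpow_mul (abs_nonneg _), mul_div_cancel₀ _ hp0.ne', mul_div_cancel₀ _ hp0.ne']
    congr 2
    rw [← sq_abs (g ω)]; norm_cast
  have hfm := (integrable_abs_rpow hm f)
  have hgm := (integrable_abs_rpow hm g)
  have hH := ENNReal.lintegral_mul_norm_pow_le (μ := P)
    hfm.aestronglyMeasurable.aemeasurable.ennreal_ofReal
    hgm.aestronglyMeasurable.aemeasurable.ennreal_ofReal
    (div_nonneg (by linarith) hp0.le : 0 ≤ (p - 2) / p) (by positivity : 0 ≤ 2 / p)
    (by field_simp; ring)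
  simp_rw [← hpdef, ← e] at hH
  rw [← ofReal_integral_eq_lintegral_ofReal hfm
      (Filter.Eventually.of_forall fun _ => by positivity),
    ← ofReal_integral_eq_lintegral_ofReal hgm
      (Filter.Eventually.of_forall fun _ => by positivity),
    ← norm_rpow_eq_integral hm, ← norm_rpow_eq_integral hm,
    ENNReal.ofReal_rpow_of_nonneg (by positivity) (div_nonneg (by linarith) hp0.le),
    ENNReal.ofReal_rpow_of_nonneg (by positivity) (by positivity),
    ← ENNReal.ofReal_mul (by positivity), ← Real.rpow_mul (norm_nonneg _),
    ← Real.rpow_mul (norm_nonneg _), ← hpdef, mul_div_cancel₀ _ hp0.ne',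
    mul_div_cancel₀ _ hp0.ne'] at hH
  have hmeas : AEStronglyMeasurable (fun ω => |f ω| ^ (p - 2) * g ω ^ 2) P :=
    (((Lp.aestronglyMeasurable f).aemeasurable.abs.pow_const _).mul
      ((Lp.aestronglyMeasurable g).aemeasurable.pow_const 2)).aestronglyMeasurable
  have hnn : 0 ≤ᵐ[P] fun ω => |f ω| ^ (p - 2) * g ω ^ 2 :=
    Filter.Eventually.of_forall fun _ => by positivity
  constructor
  · refine ⟨hmeas, ?_⟩
    rw [hasFiniteIntegral_iff_ofReal hnn]
    exact hH.trans_lt ENNReal.ofReal_lt_top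
  · rw [integral_eq_lintegral_of_nonneg_ae hnn hmeas]
    refine (ENNReal.toReal_mono ENNReal.ofReal_ne_top hH).trans_eq ?_
    rw [ENNReal.toReal_ofReal (by positivity)]
    norm_cast

end Lp

/-! ### Martingale type two of `L^m` -/

/-- `L^m` has martingale type two for `m ∈ [2, ∞)`. -/
theorem exists_norm_add_sq_le {m : ℝ≥0∞} [Fact (1 ≤ m)] (hm : m ≠ ∞) (hm2 : 2 ≤ m) :
    ∃ c : ℝ, 0 ≤ c ∧ ∀ (Ω : Type*) (G mΩ : MeasurableSpace Ω) (P : Measure Ω)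
      [IsProbabilityMeasure P], G ≤ mΩ →
      ∀ f ∈ lpMeas ℝ ℝ G m P, ∀ g ∈ condNull P m G, ‖f + g‖ ^ 2 ≤ ‖f‖ ^ 2 + c * ‖g‖ ^ 2 := by
  have hp : 2 ≤ m.toReal := by
    simpa using ENNReal.toReal_mono hm hm2
  obtain ⟨C, hC, hpt⟩ := exists_abs_add_rpow_le hp
  refine ⟨2 * C + 1, by positivity, ?_⟩
  intro Ω G mΩ P _ hG f hf g hg
  obtain ⟨hI2, hH⟩ := integral_abs_rpow_mul_sq_le hm hm2 f g
  -- The case `g = f` gives integrability of `|f|^{p-2} f²`, needed to dominate the linear Taylor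
  -- term by `|f|^{p-2} (f² + g²)`.
  obtain ⟨hI3, hH3⟩ := integral_abs_rpow_mul_sq_le hm hm2 f f
  have hfG : AEStronglyMeasurable[G] f P := mem_lpMeas_iff_aestronglyMeasurable.1 hf
  set p := m.toReal with hpdef
  have hmeas : AEStronglyMeasurable (fun ω => |f ω| ^ (p - 2) * f ω * g ω) P :=
    ((((Lp.aestronglyMeasurable f).aemeasurable.abs.pow_const _).mul
      (Lp.aestronglyMeasurable f).aemeasurable).mul
      (Lp.aestronglyMeasurable g).aemeasurable).aestronglyMeasurable
  have hI1 : Integrable (fun ω => |f ω| ^ (p - 2) * f ω * g ω) P := by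
    refine (hI2.add hI3).mono' hmeas (Filter.Eventually.of_forall fun ω => ?_)
    have h0 : 0 ≤ |f ω| ^ (p - 2) := by positivity
    rw [Real.norm_eq_abs, abs_mul, abs_mul, abs_of_nonneg h0, mul_assoc]
    simp only [Pi.add_apply]
    rw [← mul_add]
    refine mul_le_mul_of_nonneg_left ?_ h0
    rw [← sq_abs (g ω), ← sq_abs (f ω)]
    nlinarith [sq_nonneg (|f ω| - |g ω|), sq_nonneg (|f ω|), sq_nonneg (|g ω|)]
  -- The linear term vanishes: `|f|^{p-2} f` is `G`-measurable and can be pulled out of the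
  -- conditional expectation of the centred `g`.
  have hzero : ∫ ω, |f ω| ^ (p - 2) * f ω * g ω ∂P = 0 := by
    have hsm : AEStronglyMeasurable[G] (fun ω => |f ω| ^ (p - 2) * f ω) P := by
      obtain ⟨f', hf', hff'⟩ := hfG
      refine ⟨fun ω => |f' ω| ^ (p - 2) * f' ω, ?_, ?_⟩
      · have hφ : Measurable fun x : ℝ => |x| ^ (p - 2) * x := by fun_prop
        exact (hφ.comp hf'.measurable).stronglyMeasurable
      · filter_upwards [hff'] with ω h
        rw [h]
    have h1 := condExp_mul_of_aestronglyMeasurable_left hsm hI1 (integrable_coe_Lp g)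
    rw [← integral_condExp hG]
    refine (integral_congr_ae h1).trans ?_
    refine integral_eq_zero_of_ae ?_
    filter_upwards [condExp_eq_zero_of_mem_condNull hG hg] with ω h
    simp [h]
  have hmain : ‖f + g‖ ^ p ≤ ‖f‖ ^ p + C * (‖f‖ ^ (p - 2) * ‖g‖ ^ 2 + ‖g‖ ^ p) := by
    rw [hpdef, norm_rpow_eq_integral hm (f + g), norm_rpow_eq_integral hm f,
      norm_rpow_eq_integral hm g, ← hpdef]
    have hIf : Integrable (fun ω => |f ω| ^ p) P := integrable_abs_rpow hm f
    have hIg : Integrable (fun ω => |g ω| ^ p) P := integrable_abs_rpow hm g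
    calc ∫ ω, |(f + g : Lp ℝ m P) ω| ^ p ∂P
        ≤ ∫ ω, (|f ω| ^ p + p * (|f ω| ^ (p - 2) * f ω * g ω)
            + C * (|f ω| ^ (p - 2) * g ω ^ 2 + |g ω| ^ p)) ∂P := by
          refine integral_mono_ae (integrable_abs_rpow hm (f + g))
            ((hIf.add (hI1.const_mul p)).add ((hI2.add hIg).const_mul C)) ?_
          filter_upwards [Lp.coeFn_add f g] with ω h
          rw [h]
          exact hpt _ _
      _ = ∫ ω, |f ω| ^ p ∂P
            + C * (∫ ω, |f ω| ^ (p - 2) * g ω ^ 2 ∂P + ∫ ω, |g ω| ^ p ∂P) := by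
          rw [integral_add (by fun_prop) (by fun_prop), integral_add hIf (hI1.const_mul p), integral_const_mul, integral_const_mul, hzero,
            integral_add hI2 hIg]
          ring
      _ ≤ _ := by gcongr
  -- With exponent `p / 2` on squared norms, the `p`-th moment bound becomes a comparison of `p /
  -- 2`-th powers, and the power can be removed.
  have hnum := rpow_add_ge (sq_nonneg ‖f‖) (sq_nonneg ‖g‖) hC (by linarith : 1 ≤ p / 2)
  have conv : ∀ (x r : ℝ), 0 ≤ x → (x ^ 2) ^ r = x ^ (2 * r) := fun x r hx => by
    rw [← Real.rpow_natCast, ← Real.rpow_mul hx]; norm_num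
  rw [conv _ _ (norm_nonneg f), conv _ _ (norm_nonneg f), conv _ _ (norm_nonneg g),
    show 2 * (p / 2) = p by ring, show 2 * (p / 2 - 1) = p - 2 by ring] at hnum
  have hfin := hmain.trans hnum
  rw [show ‖f + g‖ ^ p = (‖f + g‖ ^ 2) ^ (p / 2) by
    rw [conv _ _ (norm_nonneg _)]; congr 1; ring] at hfin
  exact (Real.rpow_le_rpow_iff (sq_nonneg _) (by positivity) (by linarith)).1 hfin

/-! ### Stochastic sewing in an abstract Banach space -/

section Sewing

open Filter Topology

variable {E : Type*} [NormedAddCommGroup E] [NormedSpace ℝ E]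

/-- An increasing family `V` of closed subspaces ("adapted" vectors) and a decreasing family `N` of
closed subspaces ("centred" vectors), for which the martingale type two inequality holds with
constant `c`. -/
structure MartingaleScale (V N : ℝ → Submodule ℝ E) (c : ℝ) : Prop where
  nonneg : 0 ≤ c
  mono : Monotone V
  anti : Antitone N
  isClosed_adapted : ∀ t, IsClosed (V t : Set E)
  isClosed_centred : ∀ t, IsClosed (N t : Set E)
  norm_add_sq_le : ∀ t, ∀ x ∈ V t, ∀ y ∈ N t, ‖x + y‖ ^ 2 ≤ ‖x‖ ^ 2 + c * ‖y‖ ^ 2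

/-- A germ on `[s, t]` in the sense of stochastic sewing: adapted, Hölder continuous of order `γ`,
with centred defects of additivity. -/
structure IsSewingGerm (V N : ℝ → Submodule ℝ E) (a : ℝ → ℝ → E) (s t W γ : ℝ) : Prop where
  nonneg : 0 ≤ W
  mem : ∀ u v, s ≤ u → u ≤ v → v ≤ t → a u v ∈ V u
  norm_le : ∀ u v, s ≤ u → u ≤ v → v ≤ t → ‖a u v‖ ≤ W * (v - u) ^ γ
  defect : ∀ u v w, s ≤ u → u ≤ v → v ≤ w → w ≤ t → a u w - a u v - a v w ∈ N u

/-- The Riemann sum of `a` over the first `n` intervals of the partition `q`. -/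
def riemannSum (a : ℝ → ℝ → E) (q : ℕ → ℝ) (n : ℕ) : E :=
  ∑ i ∈ Finset.range n, a (q i) (q (i + 1))

variable {V N : ℝ → Submodule ℝ E} {c : ℝ} {a : ℝ → ℝ → E} {s t W γ : ℝ}

theorem IsSewingGerm.self_eq_zero (ha : IsSewingGerm V N a s t W γ) (hγ : 0 < γ) {u : ℝ}
    (hs : s ≤ u) (ht : u ≤ t) : a u u = 0 := by
  have := ha.norm_le u u hs le_rfl ht
  rw [sub_self, Real.zero_rpow hγ.ne', mul_zero] at this
  simpa using this

theorem IsSewingGerm.norm_defect_le (ha : IsSewingGerm V N a s t W γ) (hγ : 0 < γ) {u v w : ℝ}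
    (hs : s ≤ u) (huv : u ≤ v) (hvw : v ≤ w) (ht : w ≤ t) :
    ‖a u w - a u v - a v w‖ ≤ 3 * W * (w - u) ^ γ := by
  have h1 := ha.norm_le u w hs (huv.trans hvw) ht
  have h2 := ha.norm_le u v hs huv (hvw.trans ht)
  have h3 := ha.norm_le v w (hs.trans huv) hvw ht
  have h4 : W * (v - u) ^ γ ≤ W * (w - u) ^ γ :=
    mul_le_mul_of_nonneg_left (Real.rpow_le_rpow (by linarith) (by linarith) hγ.le) ha.nonneg
  have h5 : W * (w - v) ^ γ ≤ W * (w - u) ^ γ :=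
    mul_le_mul_of_nonneg_left (Real.rpow_le_rpow (by linarith) (by linarith) hγ.le) ha.nonneg
  have := norm_sub_le (a u w - a u v) (a v w)
  have := norm_sub_le (a u w) (a u v)
  linarith

namespace MartingaleScale

/-- Induction with the type two inequality at time `q n`: the partial sum is adapted there and the
next difference is centred. -/
theorem sum_mem_and_norm_sq_le (hS : MartingaleScale V N c) {q : ℕ → ℝ} (hq : Monotone q)
    {d : ℕ → E} : ∀ {n : ℕ}, (∀ i < n, d i ∈ V (q (i + 1))) → (∀ i < n, d i ∈ N (q i)) →
    ∑ i ∈ Finset.range n, d i ∈ V (q n) ∧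
      ‖∑ i ∈ Finset.range n, d i‖ ^ 2 ≤ c * ∑ i ∈ Finset.range n, ‖d i‖ ^ 2
  | 0, _, _ => by simp
  | n + 1, hV, hN => by
    obtain ⟨h1, h2⟩ := sum_mem_and_norm_sq_le hS hq (n := n)
      (fun i hi => hV i (hi.trans n.lt_succ_self)) (fun i hi => hN i (hi.trans n.lt_succ_self))
    rw [Finset.sum_range_succ, Finset.sum_range_succ]
    refine ⟨add_mem (hS.mono (hq n.le_succ) h1) (hV n n.lt_succ_self), ?_⟩
    have := hS.norm_add_sq_le _ _ h1 _ (hN n n.lt_succ_self)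
    linarith

/-- Sums of martingale differences of Hölder size at least `1/2`. -/
theorem norm_sum_le (hS : MartingaleScale V N c) {q : ℕ → ℝ} (hq : Monotone q)
    {d : ℕ → E} {n : ℕ} (hV : ∀ i < n, d i ∈ V (q (i + 1))) (hN : ∀ i < n, d i ∈ N (q i))
    (hW : 0 ≤ W) (hγ : 1 / 2 ≤ γ) {δ : ℝ} (hδ : 0 ≤ δ)
    (hd : ∀ i < n, ‖d i‖ ≤ W * (q (i + 1) - q i) ^ γ) (hgap : ∀ i < n, q (i + 1) - q i ≤ δ) :
    ‖∑ i ∈ Finset.range n, d i‖ ≤ √c * W * √(q n - q 0) * δ ^ (γ - 1 / 2) := by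
  have hc := hS.nonneg
  refine le_of_sq_le_sq ?_ (by positivity)
  have hlen : 0 ≤ q n - q 0 := sub_nonneg.2 (hq n.zero_le)
  have hsq : ∀ x r : ℝ, 0 ≤ x → (x ^ r) ^ 2 = x ^ (2 * r) := fun x r hx => by
    rw [← Real.rpow_natCast, ← Real.rpow_mul hx, mul_comm]; norm_num
  rw [mul_pow, mul_pow, mul_pow, Real.sq_sqrt hc, Real.sq_sqrt hlen, hsq _ _ hδ]
  refine (hS.sum_mem_and_norm_sq_le hq hV hN).2.trans ?_
  -- With `h` the gap, split `h^{2γ}` as `h^{2γ-1} h`: the first factor is at most `δ^{2γ-1}` since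
  -- `γ ≥ 1/2`, and the remaining gaps telescope.
  have hterm : ∀ i ∈ Finset.range n,
      ‖d i‖ ^ 2 ≤ W ^ 2 * δ ^ (2 * (γ - 1 / 2)) * (q (i + 1) - q i) := by
    intro i hi
    have hi' := Finset.mem_range.1 hi
    have h0 : 0 ≤ q (i + 1) - q i := sub_nonneg.2 (hq i.le_succ)
    calc ‖d i‖ ^ 2 ≤ (W * (q (i + 1) - q i) ^ γ) ^ 2 :=
          pow_le_pow_left₀ (norm_nonneg _) (hd i hi') 2
      _ = W ^ 2 * ((q (i + 1) - q i) ^ (2 * (γ - 1 / 2)) * (q (i + 1) - q i)) := by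
          rw [mul_pow, hsq _ _ h0]
          congr 1
          rcases h0.eq_or_lt with h | h
          · rw [← h, Real.zero_rpow (by linarith)]; simp
          · rw [← Real.rpow_add_one h.ne']; congr 1; ring
      _ ≤ W ^ 2 * (δ ^ (2 * (γ - 1 / 2)) * (q (i + 1) - q i)) := by
          gcongr
          exact hgap i hi'
      _ = _ := by ring
  calc c * ∑ i ∈ Finset.range n, ‖d i‖ ^ 2
      ≤ c * ∑ i ∈ Finset.range n, W ^ 2 * δ ^ (2 * (γ - 1 / 2)) * (q (i + 1) - q i) :=
        mul_le_mul_of_nonneg_left (Finset.sum_le_sum hterm) hc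
    _ = _ := by rw [← Finset.mul_sum, Finset.sum_range_sub]; ring

theorem riemannSum_mem (hS : MartingaleScale V N c) (ha : IsSewingGerm V N a s t W γ)
    {q : ℕ → ℝ} (hq : Monotone q) {n : ℕ} (h0 : s ≤ q 0) (hn : q n ≤ t) :
    riemannSum a q n ∈ V (q n) := by
  refine Submodule.sum_mem _ fun i hi => ?_
  have hi' := Finset.mem_range.1 hi
  exact hS.mono (hq hi'.le) (ha.mem _ _ (h0.trans (hq i.zero_le)) (hq i.le_succ)
    ((hq hi').trans hn))

omit [NormedSpace ℝ E] in
theorem sum_range_two_mul (f : ℕ → E) (n : ℕ) :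
    ∑ i ∈ Finset.range (2 * n), f i = ∑ i ∈ Finset.range n, (f (2 * i) + f (2 * i + 1)) := by
  induction n with
  | zero => simp
  | succ n ih =>
    rw [mul_add, mul_one, Finset.sum_range_succ, Finset.sum_range_succ, ih, Finset.sum_range_succ]
    abel

/-- Refining a partition by one point in every interval. -/
theorem riemannSum_refine (hS : MartingaleScale V N c) (ha : IsSewingGerm V N a s t W γ)
    (hγ : 1 / 2 ≤ γ) {q : ℕ → ℝ} (hq : Monotone q) {n : ℕ} (h0 : s ≤ q 0) (hn : q (2 * n) ≤ t)
    {δ : ℝ} (hδ : 0 ≤ δ) (hgap : ∀ i < n, q (2 * (i + 1)) - q (2 * i) ≤ δ) :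
    riemannSum a q (2 * n) - riemannSum a (fun i => q (2 * i)) n ∈ N (q 0) ∧
      ‖riemannSum a q (2 * n) - riemannSum a (fun i => q (2 * i)) n‖ ≤
        √c * (3 * W) * √(q (2 * n) - q 0) * δ ^ (γ - 1 / 2) := by
  -- Fine minus coarse sum is minus the sum of the defects; each is centred at the left end and
  -- adapted at the right end of its coarse interval.
  set d : ℕ → E := fun i => -(a (q (2 * i)) (q (2 * (i + 1))) - a (q (2 * i)) (q (2 * i + 1)) -
    a (q (2 * i + 1)) (q (2 * (i + 1)))) with hd
  have e : riemannSum a q (2 * n) - riemannSum a (fun i => q (2 * i)) n =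
      ∑ i ∈ Finset.range n, d i := by
    rw [riemannSum, riemannSum, sum_range_two_mul, ← Finset.sum_sub_distrib]
    refine Finset.sum_congr rfl fun i _ => ?_
    simp only [hd, mul_add, mul_one, add_assoc, Nat.reduceAdd]
    abel
  have hmono : Monotone fun i => q (2 * i) := fun i j hij => hq (by omega)
  have hlow : ∀ i, s ≤ q i := fun i => h0.trans (hq i.zero_le)
  have hup : ∀ i < n, q (2 * (i + 1)) ≤ t := fun i hi => (hq (by omega)).trans hn
  have h1 : ∀ i, q (2 * i) ≤ q (2 * i + 1) := fun i => hq (by omega)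
  have h2 : ∀ i, q (2 * i + 1) ≤ q (2 * (i + 1)) := fun i => hq (by omega)
  have hN : ∀ i < n, d i ∈ N (q (2 * i)) := fun i hi =>
    neg_mem (ha.defect _ _ _ (hlow _) (h1 i) (h2 i) (hup i hi))
  rw [e]
  refine ⟨Submodule.sum_mem _ fun i hi => hS.anti (hq (Nat.zero_le _))
    (hN i (Finset.mem_range.1 hi)), ?_⟩
  refine hS.norm_sum_le (q := fun i => q (2 * i)) hmono (fun i hi => ?_) hN
    (by have := ha.nonneg; positivity) hγ hδ (fun i hi => ?_) hgap
  · refine neg_mem (sub_mem (sub_mem ?_ ?_) ?_)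
    · exact hS.mono (hmono i.le_succ) (ha.mem _ _ (hlow _) (hmono i.le_succ) (hup i hi))
    · exact hS.mono (hmono i.le_succ) (ha.mem _ _ (hlow _) (h1 i) ((h2 i).trans (hup i hi)))
    · exact hS.mono (h2 i) (ha.mem _ _ (hlow _) (h2 i) (hup i hi))
  · rw [hd, norm_neg]
    exact ha.norm_defect_le (by linarith) (hlow _) (h1 i) (h2 i) (hup i hi)

/-- Riemann sums along successively halved partitions converge. -/
theorem exists_tendsto_riemannSum [CompleteSpace E] (hS : MartingaleScale V N c)
    (ha : IsSewingGerm V N a s t W γ) (hγ : 1 / 2 ≤ γ) {Q : ℕ → ℕ → ℝ}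
    (hmono : ∀ n, Monotone (Q n)) (hstep : ∀ n i, Q (n + 1) (2 * i) = Q n i)
    (hs : Q 0 0 = s) (ht : Q 0 1 = t) {δ : ℕ → ℝ} (hδ : ∀ n, 0 ≤ δ n)
    (hgap : ∀ n i, Q n (i + 1) - Q n i ≤ δ n) {B ρ : ℝ} (hρ : ρ < 1)
    (hδρ : ∀ n, δ n ^ (γ - 1 / 2) ≤ B * ρ ^ n) :
    ∃ I : E, Tendsto (fun n => riemannSum a (Q n) (2 ^ n)) atTop (𝓝 I) ∧ I ∈ V t ∧
      I - a s t ∈ N s ∧ ‖I - a s t‖ ≤ √c * (3 * W) * √(t - s) * B / (1 - ρ) := by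
  have hQs : ∀ n, Q n 0 = s := fun n => by
    induction n with
    | zero => exact hs
    | succ n ih => rw [← ih, ← hstep n 0, mul_zero]
  have hQt : ∀ n, Q n (2 ^ n) = t := fun n => by
    induction n with
    | zero => exact ht
    | succ n ih => rw [← ih, ← hstep n, pow_succ, mul_comm]
  have hlevel : ∀ n, riemannSum a (Q (n + 1)) (2 ^ (n + 1)) - riemannSum a (Q n) (2 ^ n) ∈ N s ∧
      ‖riemannSum a (Q (n + 1)) (2 ^ (n + 1)) - riemannSum a (Q n) (2 ^ n)‖ ≤
        √c * (3 * W) * √(t - s) * B * ρ ^ n := fun n => by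
    have h := hS.riemannSum_refine ha hγ (hmono (n + 1)) (n := 2 ^ n) (hQs _).ge
      (by rw [hstep, hQt]) (hδ n) (fun i _ => by rw [hstep, hstep]; exact hgap n i)
    simp only [hstep] at h
    rw [hQs, hQt] at h
    rw [pow_succ' 2 n]
    refine ⟨h.1, h.2.trans ?_⟩
    rw [mul_assoc _ B]
    have := ha.nonneg
    exact mul_le_mul_of_nonneg_left (hδρ n) (by positivity)
  have hdist : ∀ n, dist (riemannSum a (Q n) (2 ^ n)) (riemannSum a (Q (n + 1)) (2 ^ (n + 1))) ≤
      √c * (3 * W) * √(t - s) * B * ρ ^ n := fun n => by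
    rw [dist_comm, dist_eq_norm]; exact (hlevel n).2
  have hzero : riemannSum a (Q 0) (2 ^ 0) = a s t := by simp [riemannSum, hs, ht]
  obtain ⟨I, hI⟩ := cauchySeq_tendsto_of_complete (cauchySeq_of_le_geometric ρ _ hρ hdist)
  refine ⟨I, hI, ?_, ?_, ?_⟩
  · refine (hS.isClosed_adapted t).mem_of_tendsto hI (Eventually.of_forall fun n => ?_)
    have := hS.riemannSum_mem ha (hmono n) (n := 2 ^ n) (hQs n).ge (hQt n).le
    rwa [hQt] at this
  · refine (hS.isClosed_centred s).mem_of_tendsto (hI.sub_const (a s t))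
      (Eventually.of_forall fun n => ?_)
    show _ ∈ N s
    rw [← hzero, ← Finset.sum_range_sub (fun n => riemannSum a (Q n) (2 ^ n))]
    exact Submodule.sum_mem _ fun i _ => (hlevel i).1
  · have := dist_le_of_le_geometric_of_tendsto₀ ρ _ hρ hdist hI
    rwa [dist_comm, dist_eq_norm, hzero] at this

theorem div_two_pow_rpow {x : ℝ} (hx : 0 ≤ x) (κ : ℝ) (n : ℕ) :
    (x / 2 ^ n) ^ κ = x ^ κ * ((1 / 2 : ℝ) ^ κ) ^ n := by
  rw [div_eq_mul_one_div, Real.mul_rpow hx (by positivity), ← one_div_pow,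
    ← Real.rpow_natCast, ← Real.rpow_mul (by norm_num), ← Real.rpow_natCast,
    ← Real.rpow_mul (by norm_num), mul_comm κ]

theorem half_rpow_lt_one {κ : ℝ} (hκ : 0 < κ) : (1 / 2 : ℝ) ^ κ < 1 :=
  Real.rpow_lt_one (by norm_num) (by norm_num) hκ

/-- The sharp estimate: the limit along the dyadic partitions of `[s, t]` itself. -/
theorem exists_tendsto_riemannSum_uniform [CompleteSpace E] (hS : MartingaleScale V N c)
    (ha : IsSewingGerm V N a s t W γ) (hγ : 1 / 2 < γ) (hst : s ≤ t) :
    ∃ I : E, Tendsto (fun n : ℕ => riemannSum a (fun i => s + i * ((t - s) / 2 ^ n)) (2 ^ n))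
      atTop (𝓝 I) ∧
      ‖I - a s t‖ ≤ 3 * √c / (1 - (1 / 2 : ℝ) ^ (γ - 1 / 2)) * W * (t - s) ^ γ := by
  have h0 : 0 ≤ t - s := sub_nonneg.2 hst
  -- Unification takes `B = (t - s)^{γ-1/2}` and `ρ = (1/2)^{γ-1/2}`; `√(t - s) * B` then restores
  -- the full power `(t - s)^γ`.
  obtain ⟨I, hI, -, -, hle⟩ := hS.exists_tendsto_riemannSum ha hγ.le
    (Q := fun n i => s + i * ((t - s) / 2 ^ n)) (fun n i j hij => by dsimp only; gcongr)
    (fun n i => by push_cast; field_simp; ring) (by simp) (by simp)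
    (δ := fun n => (t - s) / 2 ^ n) (fun n => by positivity)
    (fun n i => by push_cast; linarith) (half_rpow_lt_one (sub_pos.2 hγ))
    (fun n => (div_two_pow_rpow h0 _ n).le)
  refine ⟨I, hI, hle.trans_eq ?_⟩
  have : √(t - s) * (t - s) ^ (γ - 1 / 2) = (t - s) ^ γ := by
    rcases h0.eq_or_lt with h | h
    · rw [← h, Real.zero_rpow (by linarith), Real.zero_rpow (by linarith), mul_zero]
    · rw [Real.sqrt_eq_rpow, ← Real.rpow_add h]; congr 1; ring
  rw [← this]
  ring

/-- Splitting the Riemann sum at a point `u`. -/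
theorem norm_riemannSum_split_le (hS : MartingaleScale V N c) (ha : IsSewingGerm V N a s t W γ)
    (hγ : 1 / 2 ≤ γ) {q : ℕ → ℝ} (hq : Monotone q) {n : ℕ} (h0 : s ≤ q 0) (hn : q n ≤ t)
    {δ : ℝ} (hδ : 0 ≤ δ) (hgap : ∀ i < n, q (i + 1) - q i ≤ δ) {u : ℝ} (hsu : s ≤ u)
    (hut : u ≤ t) :
    ‖riemannSum a (fun i => min (q i) u) n + riemannSum a (fun i => max (q i) u) n -
      riemannSum a q n‖ ≤ √c * (3 * W) * √(q n - q 0) * δ ^ (γ - 1 / 2) := by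
  have hγ0 : 0 < γ := by linarith
  have hW := ha.nonneg
  rw [riemannSum, riemannSum, riemannSum, ← Finset.sum_add_distrib, ← Finset.sum_sub_distrib]
  have key : ∀ i < n, ∀ d, d = a (min (q i) u) (min (q (i + 1)) u) +
      a (max (q i) u) (max (q (i + 1)) u) - a (q i) (q (i + 1)) →
      d ∈ V (q (i + 1)) ∧ d ∈ N (q i) ∧ ‖d‖ ≤ 3 * W * (q (i + 1) - q i) ^ γ := by
    intro i hi d hd
    have hlow : s ≤ q i := h0.trans (hq i.zero_le)
    have hup : q (i + 1) ≤ t := (hq hi).trans hn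
    have hle : q i ≤ q (i + 1) := hq i.le_succ
    have hz := ha.self_eq_zero hγ0 hsu hut
    -- Intervals on one side of `u` contribute nothing, since the extra term is `a u u = 0`. Only an
    -- interval around `u` produces a defect.
    have hd0 : d = 0 → d ∈ V (q (i + 1)) ∧ d ∈ N (q i) ∧ ‖d‖ ≤ 3 * W * (q (i + 1) - q i) ^ γ := by
      rintro rfl
      refine ⟨zero_mem _, zero_mem _, ?_⟩
      rw [norm_zero]
      have : 0 ≤ q (i + 1) - q i := sub_nonneg.2 hle
      positivity
    rcases le_total u (q i) with h | h
    · exact hd0 (by rw [hd, min_eq_right h, min_eq_right (h.trans hle), max_eq_left h,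
        max_eq_left (h.trans hle), hz]; abel)
    rcases le_total (q (i + 1)) u with h' | h'
    · exact hd0 (by rw [hd, min_eq_left h, min_eq_left h', max_eq_right h,
        max_eq_right h', hz]; abel)
    rw [min_eq_left h, min_eq_right h', max_eq_right h, max_eq_left h'] at hd
    have hd' : d = -(a (q i) (q (i + 1)) - a (q i) u - a u (q (i + 1))) := by rw [hd]; abel
    refine ⟨?_, ?_, ?_⟩
    · rw [hd]
      exact sub_mem (add_mem (hS.mono hle (ha.mem _ _ hlow h hut))
        (hS.mono h' (ha.mem _ _ hsu h' hup))) (hS.mono hle (ha.mem _ _ hlow hle hup))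
    · rw [hd']
      exact neg_mem (ha.defect _ _ _ hlow h h' hup)
    · rw [hd', norm_neg]
      exact ha.norm_defect_le hγ0 hlow h h' hup
  exact hS.norm_sum_le hq (fun i hi => (key i hi _ rfl).1) (fun i hi => (key i hi _ rfl).2.1)
    (by positivity) hγ hδ (fun i hi => (key i hi _ rfl).2.2) hgap

/-- A path whose increments approximate the germ is the limit of its Riemann sums. -/
theorem norm_sub_riemannSum_le (hS : MartingaleScale V N c) {T : ℝ} {I : ℝ → E}
    (hV : ∀ v, 0 ≤ v → v ≤ T → I v ∈ V v)
    (ha : ∀ u v, 0 ≤ u → u ≤ v → v ≤ T → a u v ∈ V u)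
    (hN : ∀ u v, 0 ≤ u → u ≤ v → v ≤ T → I v - I u - a u v ∈ N u)
    (hW : 0 ≤ W) (hγ : 1 / 2 ≤ γ)
    (hI : ∀ u v, 0 ≤ u → u ≤ v → v ≤ T → ‖I v - I u - a u v‖ ≤ W * (v - u) ^ γ)
    {q : ℕ → ℝ} (hq : Monotone q) {n : ℕ} (h0 : 0 ≤ q 0) (hn : q n ≤ T)
    {δ : ℝ} (hδ : 0 ≤ δ) (hgap : ∀ i < n, q (i + 1) - q i ≤ δ) :
    ‖I (q n) - I (q 0) - riemannSum a q n‖ ≤ √c * W * √(q n - q 0) * δ ^ (γ - 1 / 2) := by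
  rw [riemannSum, ← Finset.sum_range_sub (fun i => I (q i)), ← Finset.sum_sub_distrib]
  have hlow : ∀ i, 0 ≤ q i := fun i => h0.trans (hq i.zero_le)
  have hup : ∀ i < n, q (i + 1) ≤ T := fun i hi => (hq hi).trans hn
  exact hS.norm_sum_le hq (fun i hi => sub_mem (sub_mem (hV _ (hlow _) (hup i hi))
      (hS.mono (hq i.le_succ) (hV _ (hlow _) ((hq i.le_succ).trans (hup i hi)))))
      (hS.mono (hq i.le_succ) (ha _ _ (hlow i) (hq i.le_succ) (hup i hi))))
    (fun i hi => hN _ _ (hlow i) (hq i.le_succ) (hup i hi)) hW hγ hδ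
    (fun i hi => hI _ _ (hlow i) (hq i.le_succ) (hup i hi)) hgap

/-- Serves as uniqueness: a path with centred remainders of order above `1/2` is determined by its
germ. It transfers the sharp estimate to the path and gives linearity of the final operator. -/
theorem tendsto_riemannSum (hS : MartingaleScale V N c) {T : ℝ} {I : ℝ → E}
    (hV : ∀ v, 0 ≤ v → v ≤ T → I v ∈ V v)
    (ha : ∀ u v, 0 ≤ u → u ≤ v → v ≤ T → a u v ∈ V u)
    (hN : ∀ u v, 0 ≤ u → u ≤ v → v ≤ T → I v - I u - a u v ∈ N u)
    (hW : 0 ≤ W) (hγ : 1 / 2 < γ)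
    (hI : ∀ u v, 0 ≤ u → u ≤ v → v ≤ T → ‖I v - I u - a u v‖ ≤ W * (v - u) ^ γ)
    {u v : ℝ} (hu : 0 ≤ u) (huv : u ≤ v) (hv : v ≤ T) :
    Tendsto (fun n : ℕ => riemannSum a (fun i => u + i * ((v - u) / 2 ^ n)) (2 ^ n)) atTop
      (𝓝 (I v - I u)) := by
  have hd : 0 ≤ v - u := sub_nonneg.2 huv
  have hg : Tendsto (fun n : ℕ => √c * W * √(v - u) * ((v - u) / 2 ^ n) ^ (γ - 1 / 2))
      atTop (𝓝 0) := by
    have := (tendsto_pow_atTop_nhds_zero_of_lt_one (by positivity)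
      (half_rpow_lt_one (sub_pos.2 hγ))).const_mul (√c * W * √(v - u) * (v - u) ^ (γ - 1 / 2))
    rw [mul_zero] at this
    refine this.congr fun n => ?_
    rw [div_two_pow_rpow hd]; ring
  rw [tendsto_iff_norm_sub_tendsto_zero]
  refine squeeze_zero (fun _ => norm_nonneg _) (fun n => ?_) hg
  set q : ℕ → ℝ := fun i => u + i * ((v - u) / 2 ^ n) with hq
  have hqm : Monotone q := fun i j hij => by simp only [hq]; gcongr
  have hq0 : q 0 = u := by simp [hq]
  have hqn : q (2 ^ n) = v := by simp only [hq]; push_cast; field_simp; ring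
  have := hS.norm_sub_riemannSum_le hV ha hN hW hγ.le hI hqm (n := 2 ^ n) (hq0.symm ▸ hu)
    (hqn.symm ▸ hv) (δ := (v - u) / 2 ^ n) (by positivity)
    (fun i _ => by simp only [hq]; push_cast; linarith)
  rw [hq0, hqn] at this
  rwa [norm_sub_rev]

/-- A path solving the sewing problem, with a non-optimal remainder estimate. -/
theorem exists_path [CompleteSpace E] (hS : MartingaleScale V N c) {T : ℝ} (hT : 0 ≤ T)
    (ha : IsSewingGerm V N a 0 T W γ) (hγ : 1 / 2 < γ) :
    ∃ (I : ℝ → E) (W' : ℝ), I 0 = 0 ∧ 0 ≤ W' ∧ (∀ v, 0 ≤ v → v ≤ T → I v ∈ V v) ∧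
      ∀ u v, 0 ≤ u → u ≤ v → v ≤ T → I v - I u - a u v ∈ N u ∧
        ‖I v - I u - a u v‖ ≤ W' * (v - u) ^ (1 / 2 + (γ - 1 / 2) / 2) := by
  set κ := γ - 1 / 2 with hκ
  have hκ0 : 0 < κ := sub_pos.2 hγ
  have hW := ha.nonneg
  have hc := hS.nonneg
  have hρ := half_rpow_lt_one (half_pos hκ0)
  set x : ℕ → ℕ → ℝ := fun n i => i * (T / 2 ^ n) with hx
  have hxmono : ∀ n, Monotone (x n) := fun n i j hij => by simp only [hx]; gcongr
  -- The grid of `[0,T]` clipped to `[u,v]`: partitions of adjacent intervals fit together, which is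
  -- what makes the limits additive.
  set Q : ℝ → ℝ → ℕ → ℕ → ℝ := fun u v n i => max u (min (x n i) v) with hQ
  have hQmono : ∀ u v n, Monotone (Q u v n) := fun u v n i j hij =>
    max_le_max_left _ (min_le_min_right _ (hxmono n hij))
  have hQgap : ∀ u v n i, u ≤ v → Q u v n (i + 1) - Q u v n i ≤ min (T / 2 ^ n) (v - u) := by
    intro u v n i huv
    have e : x n (i + 1) = x n i + T / 2 ^ n := by simp only [hx]; push_cast; ring
    have hp : 0 ≤ T / 2 ^ n := by positivity
    refine le_min ?_ ?_
    · simp only [hQ, e]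
      rw [sub_le_iff_le_add]
      refine max_le ?_ ?_
      · linarith [le_max_left u (min (x n i) v)]
      · refine le_trans ?_ (add_le_add_right (le_max_right u _) _)
        rcases le_total (x n i) v with h | h
        · rw [min_eq_left h]; linarith [min_le_left (x n i + T / 2 ^ n) v]
        · rw [min_eq_right h]; linarith [min_le_right (x n i + T / 2 ^ n) v]
    · have h1 : Q u v n (i + 1) ≤ v := max_le huv (min_le_right _ _)
      have h2 : u ≤ Q u v n i := le_max_left _ _
      linarith
  have hexists : ∀ u v, 0 ≤ u → u ≤ v → v ≤ T → ∃ J : E,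
      Tendsto (fun n => riemannSum a (Q u v n) (2 ^ n)) atTop (𝓝 J) ∧ J ∈ V v ∧
      J - a u v ∈ N u ∧ ‖J - a u v‖ ≤
        √c * (3 * W) * √(v - u) * ((v - u) ^ (κ / 2) * T ^ (κ / 2)) /
          (1 - (1 / 2 : ℝ) ^ (κ / 2)) := by
    intro u v hu huv hv
    have ha' : IsSewingGerm V N a u v W γ :=
      ⟨hW, fun y z hy hyz hz => ha.mem y z (hu.trans hy) hyz (hz.trans hv),
        fun y z hy hyz hz => ha.norm_le y z (hu.trans hy) hyz (hz.trans hv),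
        fun y z w hy hyz hzw hw => ha.defect y z w (hu.trans hy) hyz hzw (hw.trans hv)⟩
    refine hS.exists_tendsto_riemannSum ha' hγ.le (hQmono u v) ?_ ?_ ?_
      (δ := fun n => min (T / 2 ^ n) (v - u)) (fun n => le_min (by positivity) (by linarith))
      (fun n i => hQgap u v n i huv) hρ ?_
    · intro n i
      have : x (n + 1) (2 * i) = x n i := by
        simp only [hx]; push_cast; field_simp; ring
      simp only [hQ, this]
    · simp only [hQ, hx]
      rw [Nat.cast_zero, zero_mul, min_eq_left (hu.trans huv), max_eq_left hu]
    · simp only [hQ, hx]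
      rw [Nat.cast_one, one_mul, pow_zero, div_one, min_eq_right hv, max_eq_right huv]
    · intro n
      have hd : 0 ≤ v - u := sub_nonneg.2 huv
      have hp : 0 ≤ T / 2 ^ n := by positivity
      have hm : 0 ≤ min (T / 2 ^ n) (v - u) := le_min hp hd
      -- The mesh is bounded by both `T / 2 ^ n` and `v - u`. Half of the exponent `κ` is spent on
      -- geometric decay in `n`, the other half is kept as a power of `v - u`; this is the loss in
      -- the remainder.
      calc min (T / 2 ^ n) (v - u) ^ (γ - 1 / 2)
          = min (T / 2 ^ n) (v - u) ^ (κ / 2) * min (T / 2 ^ n) (v - u) ^ (κ / 2) := by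
            rw [← Real.rpow_add_of_nonneg hm (by linarith) (by linarith)]; congr 1; ring
        _ ≤ (v - u) ^ (κ / 2) * (T / 2 ^ n) ^ (κ / 2) := by
            gcongr
            · exact min_le_right _ _
            · exact min_le_left _ _
        _ = _ := by rw [div_two_pow_rpow hT]; ring
  choose! J hJ hJV hJN hJle using hexists
  -- Clipping the partition of `[0,v]` at `u` gives those of `[0,u]` and `[u,v]`, and inserting the
  -- point `u` costs an error that vanishes with the mesh.
  have hadd : ∀ u v, 0 ≤ u → u ≤ v → v ≤ T → J 0 v - J 0 u = J u v := by
    intro u v hu huv hv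
    have hlim := ((hJ 0 u le_rfl hu (huv.trans hv)).add (hJ u v hu huv hv)).sub
      (hJ 0 v le_rfl (hu.trans huv) hv)
    have hzero : Tendsto (fun n => riemannSum a (Q 0 u n) (2 ^ n) +
        riemannSum a (Q u v n) (2 ^ n) - riemannSum a (Q 0 v n) (2 ^ n)) atTop (𝓝 0) := by
      have hg : Tendsto (fun n : ℕ => √c * (3 * W) * √T * (T / 2 ^ n) ^ (γ - 1 / 2))
          atTop (𝓝 0) := by
        have := (tendsto_pow_atTop_nhds_zero_of_lt_one (by positivity)
          (half_rpow_lt_one hκ0)).const_mul (√c * (3 * W) * √T * T ^ κ)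
        rw [mul_zero] at this
        refine this.congr fun n => ?_
        rw [← hκ, div_two_pow_rpow hT]; ring
      refine squeeze_zero_norm (fun n => ?_) hg
      have e1 : Q 0 u n = fun i => min (Q 0 v n i) u := by
        funext i
        simp only [hQ]
        rw [min_max_distrib_right, min_assoc, min_eq_right huv, min_eq_left hu]
      have e2 : Q u v n = fun i => max (Q 0 v n i) u := by
        funext i
        simp only [hQ]
        rw [max_comm 0, max_assoc, max_eq_right hu, max_comm]
      have hlow : 0 ≤ Q 0 v n 0 := le_max_left _ _
      have hup : Q 0 v n (2 ^ n) ≤ v := max_le (hu.trans huv) (min_le_right _ _)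
      rw [e1, e2]
      refine (hS.norm_riemannSum_split_le ha hγ.le (hQmono 0 v n) hlow (hup.trans hv)
        (δ := T / 2 ^ n) (by positivity)
        (fun i _ => (hQgap 0 v n i (hu.trans huv)).trans (min_le_left _ _)) hu
        (huv.trans hv)).trans ?_
      gcongr
      linarith
    have := tendsto_nhds_unique hlim hzero
    rw [sub_eq_zero] at this
    rw [← this]; abel
  have hJ0 : J 0 0 = 0 := by
    have := hadd 0 0 le_rfl le_rfl hT
    rwa [sub_self, eq_comm] at this
  refine ⟨fun v => J 0 v, √c * (3 * W) * T ^ (κ / 2) / (1 - (1 / 2 : ℝ) ^ (κ / 2)), hJ0, ?_,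
    fun v hv hvT => hJV 0 v le_rfl hv hvT, fun u v hu huv hv => ?_⟩
  · have : 0 ≤ 1 - (1 / 2 : ℝ) ^ (κ / 2) := by linarith
    positivity
  · simp only
    rw [hadd u v hu huv hv]
    refine ⟨hJN u v hu huv hv, (hJle u v hu huv hv).trans_eq ?_⟩
    rw [Real.rpow_add_of_nonneg (by linarith) (by norm_num) (by linarith), Real.sqrt_eq_rpow (v - u)]
    ring

/-- **Stochastic sewing lemma** with a control that is not assumed to be additive. -/
theorem exists_sewing [CompleteSpace E] (hS : MartingaleScale V N c) {T : ℝ} (hT : 0 ≤ T)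
    (hγ : 1 / 2 < γ) {w : ℝ → ℝ → ℝ}
    (ha : ∀ u v, 0 ≤ u → u ≤ v → v ≤ T → IsSewingGerm V N a u v (w u v) γ) :
    ∃ I : ℝ → E, I 0 = 0 ∧ (∀ v, 0 ≤ v → v ≤ T → I v ∈ V v) ∧
      ∀ u v, 0 ≤ u → u ≤ v → v ≤ T → I v - I u - a u v ∈ N u ∧
        ‖I v - I u - a u v‖ ≤
          3 * √c / (1 - (1 / 2 : ℝ) ^ (γ - 1 / 2)) * w u v * (v - u) ^ γ := by
  obtain ⟨I, W', hI0, hW', hIV, hI⟩ := hS.exists_path hT (ha 0 T le_rfl hT le_rfl) hγ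
  refine ⟨I, hI0, hIV, fun u v hu huv hv => ⟨(hI u v hu huv hv).1, ?_⟩⟩
  -- This estimate uses the germ hypothesis on `[u,v]` alone, so its constant is `w u v`; uniqueness
  -- of limits then identifies `J` with `I v - I u`.
  obtain ⟨J, hJ, hJle⟩ := hS.exists_tendsto_riemannSum_uniform (ha u v hu huv hv) hγ huv
  have hlim := hS.tendsto_riemannSum (a := a) (T := T) (I := I) (W := W')
    (γ := 1 / 2 + (γ - 1 / 2) / 2) hIV
    (fun y z hy hyz hz => (ha y z hy hyz hz).mem y z le_rfl hyz le_rfl)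
    (fun y z hy hyz hz => (hI y z hy hyz hz).1) hW' (by linarith)
    (fun y z hy hyz hz => (hI y z hy hyz hz).2) hu huv hv
  rwa [tendsto_nhds_unique hlim hJ]

end MartingaleScale

end Sewing

/-! ### Carathéodory integrands: joint measurability and Fubini -/

section Caratheodory

open Filter Topology

variable {α X : Type*} [MeasurableSpace α] {μ : Measure α} [TopologicalSpace X]
  [TopologicalSpace.MetrizableSpace X] [SecondCountableTopology X] [MeasurableSpace X]
  [OpensMeasurableSpace X]

/-- A function which is continuous in `x` and a.e. measurable in `r` for every fixed `x` agrees, for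
almost every `r` and all `x`, with a jointly measurable function. -/
theorem exists_stronglyMeasurable_uncurry {v : α → X → ℝ} (hc : ∀ᵐ r ∂μ, Continuous (v r))
    (hm : ∀ x, AEStronglyMeasurable (fun r => v r x) μ) :
    ∃ w : α → X → ℝ, StronglyMeasurable (Function.uncurry fun x r => w r x) ∧
      (∀ᵐ r ∂μ, w r = v r) := by
  -- Over a countable dense set the exceptional null sets have a null union; continuity carries
  -- measurability from `D` to every point.
  obtain ⟨D, hDc, hDd⟩ := TopologicalSpace.exists_countable_dense X
  have hgood : ∀ᵐ r ∂μ, Continuous (v r) ∧ ∀ x ∈ D, v r x = (hm x).mk _ r :=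
    hc.and ((ae_ball_iff hDc).2 fun x _ => (hm x).ae_eq_mk)
  obtain ⟨S, hS, hSm, hSv⟩ := hgood.exists_measurable_mem
  classical
  set w : α → X → ℝ := fun r x => if r ∈ S then v r x else 0 with hw
  have hwc : ∀ r, Continuous (w r) := fun r => by
    by_cases h : r ∈ S
    · simpa [hw, h] using (hSv r h).1
    · simpa [hw, h] using continuous_const
  have hwD : ∀ x ∈ D, StronglyMeasurable fun r => w r x := fun x hx => by
    have : (fun r => w r x) = S.indicator ((hm x).mk _) := by
      funext r
      by_cases h : r ∈ S
      · simp only [hw, h, if_true, indicator_of_mem, (hSv r h).2 x hx]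
      · simp [hw, h]
    rw [this]
    exact (hm x).stronglyMeasurable_mk.indicator hSm
  refine ⟨w, ?_, ?_⟩
  · refine stronglyMeasurable_uncurry_of_continuous_of_stronglyMeasurable hwc fun x => ?_
    obtain ⟨y, hyD, hy⟩ := mem_closure_iff_seq_limit.1 (hDd x)
    exact stronglyMeasurable_of_tendsto atTop (fun n => hwD (y n) (hyD n))
      (tendsto_pi_nhds.2 fun r => ((hwc r).tendsto x).comp hy)
  · filter_upwards [hS] with r hr
    funext x
    simp [hw, hr]

/-- Fubini's theorem for a dominated Carathéodory integrand composed with a random variable. -/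
theorem integral_integral_swap_caratheodory [SFinite μ] {Ω : Type*} [MeasurableSpace Ω]
    {ρ : Measure Ω} [IsFiniteMeasure ρ] {v : α → X → ℝ} {b : α → ℝ}
    (hc : ∀ᵐ r ∂μ, Continuous (v r))
    (hm : ∀ x, AEStronglyMeasurable (fun r => v r x) μ) (hb : Integrable b μ)
    (hvb : ∀ᵐ r ∂μ, ∀ x, |v r x| ≤ b r) {Y : Ω → X} (hY : Measurable Y) :
    ∫ ω, ∫ r, v r (Y ω) ∂μ ∂ρ = ∫ r, ∫ ω, v r (Y ω) ∂ρ ∂μ := by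
  obtain ⟨w, hw, hwv⟩ := exists_stronglyMeasurable_uncurry hc hm
  have h1 : ∀ ω, ∫ r, v r (Y ω) ∂μ = ∫ r, w r (Y ω) ∂μ := fun ω =>
    integral_congr_ae (hwv.mono fun r hr => by simp only [hr])
  have h2 : ∫ r, ∫ ω, v r (Y ω) ∂ρ ∂μ = ∫ r, ∫ ω, w r (Y ω) ∂ρ ∂μ :=
    integral_congr_ae (hwv.mono fun r hr => by simp only [hr])
  simp_rw [h1]
  rw [h2]
  refine integral_integral_swap ?_
  refine (hb.comp_snd ρ).mono' ?_ ?_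
  · exact (hw.comp_measurable ((hY.comp measurable_fst).prodMk measurable_snd)).aestronglyMeasurable
  · have : ∀ᵐ r ∂μ, ∀ x, |w r x| ≤ b r := by
      filter_upwards [hwv, hvb] with r h h'
      rwa [h]
    filter_upwards [Measure.quasiMeasurePreserving_snd.ae this] with z hz
    exact hz _

end Caratheodory

/-! ### The singular weight in time -/

/-- The exponent conjugate to `q`. -/
noncomputable def dualExponent (q : ℝ≥0∞) : ℝ := (1 - (1 / q).toReal)⁻¹

theorem inv_toReal_lt_half {q : ℝ≥0∞} (hq : 2 < q) : (1 / q).toReal < 1 / 2 := by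
  have : (1 / q) < 1 / 2 := by
    rw [one_div, one_div]; exact ENNReal.inv_lt_inv.2 hq
  simpa using (ENNReal.toReal_lt_toReal (this.trans_le le_top).ne (by simp)).2 this

theorem holderTriple_dualExponent {q : ℝ≥0∞} (hq : 2 < q) :
    ENNReal.HolderTriple (ENNReal.ofReal (dualExponent q)) q 1 := by
  have hx := inv_toReal_lt_half hq
  refine ⟨?_⟩
  have hfin : q⁻¹ ≠ ∞ := ENNReal.inv_ne_top.2 (zero_lt_two.trans hq).ne'
  rw [dualExponent, ENNReal.ofReal_inv_of_pos (by linarith), inv_inv, inv_one,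
    ← ENNReal.ofReal_toReal hfin, ← one_div q,
    ← ENNReal.ofReal_add (by linarith) ENNReal.toReal_nonneg]
  simp

/-- The `L^{q'}` norm of the singular weight `(r - s)^{ν/2}`. -/
theorem exists_eLpNorm_weight_le {q : ℝ≥0∞} (hq : 2 < q) {ν : ℝ}
    (hνq : ν / 2 - (1 / q).toReal > -(1 / 2)) :
    ∃ Γ : ℝ, 0 ≤ Γ ∧ ∀ s t : ℝ, s ≤ t →
      eLpNorm (fun r : ℝ => |r - s| ^ (ν / 2)) (ENNReal.ofReal (dualExponent q))
        (volume.restrict (Icc s t)) ≤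
        ENNReal.ofReal (Γ * (t - s) ^ (1 + ν / 2 - (1 / q).toReal)) := by
  have hx := inv_toReal_lt_half hq
  have hx0 : 0 ≤ (1 / q).toReal := ENNReal.toReal_nonneg
  set x := (1 / q).toReal with hxdef
  set p := dualExponent q with hp
  have hpe : p = (1 - x)⁻¹ := rfl
  have hp0 : 0 < p := by rw [hpe]; exact inv_pos.2 (by linarith)
  set γ := 1 + ν / 2 - x with hγ
  have hγ0 : 0 < γ := by linarith
  -- Since `p (1 - 1/q) = 1`, the `p`-th power of the weight integrates to `(t - s)^{pγ} / (pγ)`,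
  -- and `γ > 0` is exactly its integrability.
  have he : ν / 2 * p + 1 = p * γ := by
    have : p * (1 - x) = 1 := by rw [hpe]; exact inv_mul_cancel₀ (by linarith)
    rw [hγ]; linarith
  have he1 : -1 < ν / 2 * p := by
    have : 0 < p * γ := by positivity
    linarith
  refine ⟨(p * γ)⁻¹ ^ p⁻¹, by positivity, fun s t hst => ?_⟩
  have hd : 0 ≤ t - s := sub_nonneg.2 hst
  have hpt : (ENNReal.ofReal p).toReal = p := ENNReal.toReal_ofReal hp0.le
  have hii : IntervalIntegrable (fun r : ℝ => (r - s) ^ (ν / 2 * p)) volume s t := by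
    have := (intervalIntegral.intervalIntegrable_rpow' (a := 0) (b := t - s) he1).comp_sub_right s
    simpa using this
  have hcongr : ∀ r ∈ Icc s t, (r - s) ^ (ν / 2 * p) = ‖|r - s| ^ (ν / 2)‖ ^ p := fun r hr => by
    have h0 : 0 ≤ r - s := sub_nonneg.2 hr.1
    rw [Real.norm_eq_abs, abs_of_nonneg (by positivity : 0 ≤ |r - s| ^ (ν / 2)),
      abs_of_nonneg h0, ← Real.rpow_mul h0]
  have hint : Integrable (fun r : ℝ => ‖|r - s| ^ (ν / 2)‖ ^ p) (volume.restrict (Icc s t)) := by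
    have := (intervalIntegrable_iff_integrableOn_Icc_of_le hst).1 hii
    exact this.congr ((ae_restrict_iff' measurableSet_Icc).2 (Filter.Eventually.of_forall hcongr))
  have hmeas : AEStronglyMeasurable (fun r : ℝ => |r - s| ^ (ν / 2))
      (volume.restrict (Icc s t)) := by
    have : Measurable (fun r : ℝ => |r - s| ^ (ν / 2)) := by fun_prop
    exact this.aestronglyMeasurable
  have hmem : MemLp (fun r : ℝ => |r - s| ^ (ν / 2)) (ENNReal.ofReal p)
      (volume.restrict (Icc s t)) := by
    rw [← integrable_norm_rpow_iff hmeas (by simpa using hp0) ENNReal.ofReal_ne_top, hpt]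
    exact hint
  rw [hmem.eLpNorm_eq_integral_rpow_norm (by simpa using hp0) ENNReal.ofReal_ne_top, hpt]
  refine ENNReal.ofReal_le_ofReal (le_of_eq ?_)
  have hval : ∫ r in Icc s t, ‖|r - s| ^ (ν / 2)‖ ^ p = (t - s) ^ (p * γ) / (p * γ) := by
    rw [← setIntegral_congr_fun measurableSet_Icc hcongr, integral_Icc_eq_integral_Ioc,
      ← intervalIntegral.integral_of_le hst,
      intervalIntegral.integral_comp_sub_right (fun r => r ^ (ν / 2 * p)),
      integral_rpow (Or.inl he1), sub_self, he, Real.zero_rpow (by positivity), sub_zero]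
  rw [hval, div_eq_mul_inv, Real.mul_rpow (by positivity) (by positivity), ← Real.rpow_mul hd,
    mul_comm p γ, mul_assoc, mul_inv_cancel₀ hp0.ne', mul_one]
  ring

theorem IsFunction.add {d : ℕ} {u v : RealTemperedDistribution d} {g k : Rd d →ᵇ ℝ}
    (hu : IsFunction u g) (hv : IsFunction v k) : IsFunction (u + v) (g + k) := fun φ => by
  have hi : ∀ h : Rd d →ᵇ ℝ, Integrable (fun x => φ x * h x) := fun h => by
    refine (φ.integrable (μ := volume)).mul_bdd (c := ‖h‖) h.continuous.aestronglyMeasurable ?_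
    exact Filter.Eventually.of_forall h.norm_coe_le_norm
  simp only [add_apply, BoundedContinuousFunction.add_apply, mul_add]
  rw [hu, hv, integral_add (hi g) (hi k)]

theorem IsFunction.smul {d : ℕ} {u : RealTemperedDistribution d} {g : Rd d →ᵇ ℝ}
    (hu : IsFunction u g) (c : ℝ) : IsFunction (c • u) (c • g) := fun φ => by
  simp only [smul_apply, BoundedContinuousFunction.smul_apply, smul_eq_mul]
  rw [hu, ← integral_const_mul]
  congr 1
  funext x
  ring

/-! ### The germ: measurability, bounds and centred defects -/

section Germ

open Filter Topology

variable {d : ℕ} {Ω : Type*} {mΩ : MeasurableSpace Ω} {P : Measure Ω}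
  {F : Filtration ℝ mΩ} {X : ℝ → Ω → Rd d} {T : ℝ} {H : Type*} [NormedAddCommGroup H]
  [NormedSpace ℝ H] {ι : H →ₗ[ℝ] RealTemperedDistribution d} {U : ℝ → ℝ → H →L[ℝ] H} {K ν : ℝ}

namespace SmoothingCondition

theorem continuous_valueAt (hS : SmoothingCondition P F X T ι U K ν) {s t : ℝ} (hs : 0 ≤ s)
    (hst : s < t) (ht : t ≤ T) (h : H) : Continuous (valueAt (ι (U s t h))) := by
  obtain ⟨g, hg, -⟩ := hS.smoothing h s t hs hst ht
  rw [funext hg.valueAt_eq]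
  exact g.continuous

theorem abs_valueAt_le (hS : SmoothingCondition P F X T ι U K ν) {s t : ℝ} (hs : 0 ≤ s)
    (hst : s < t) (ht : t ≤ T) (h : H) (x : Rd d) :
    |valueAt (ι (U s t h)) x| ≤ K * ‖h‖ * |t - s| ^ (ν / 2) := by
  obtain ⟨g, hg, hle⟩ := hS.smoothing h s t hs hst ht
  rw [hg.valueAt_eq]
  exact (g.norm_coe_le_norm x).trans hle

/-- Linearity of `valueAt` needs the summands to be functions, since it defaults to `0` elsewhere;
smoothing guarantees this for `s < t`. -/
theorem valueAt_add (hS : SmoothingCondition P F X T ι U K ν) {s t : ℝ} (hs : 0 ≤ s)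
    (hst : s < t) (ht : t ≤ T) (h k : H) (x : Rd d) :
    valueAt (ι (U s t (h + k))) x = valueAt (ι (U s t h)) x + valueAt (ι (U s t k)) x := by
  obtain ⟨g, hg, -⟩ := hS.smoothing h s t hs hst ht
  obtain ⟨g', hg', -⟩ := hS.smoothing k s t hs hst ht
  rw [map_add, map_add, (hg.add hg').valueAt_eq, hg.valueAt_eq, hg'.valueAt_eq]
  rfl

theorem valueAt_smul (hS : SmoothingCondition P F X T ι U K ν) {s t : ℝ} (hs : 0 ≤ s)
    (hst : s < t) (ht : t ≤ T) (c : ℝ) (h : H) (x : Rd d) :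
    valueAt (ι (U s t (c • h))) x = c * valueAt (ι (U s t h)) x := by
  obtain ⟨g, hg, -⟩ := hS.smoothing h s t hs hst ht
  rw [map_smul, map_smul, (hg.smul c).valueAt_eq, hg.valueAt_eq]
  rfl

theorem valueAt_sub (hS : SmoothingCondition P F X T ι U K ν) {s t : ℝ} (hs : 0 ≤ s)
    (hst : s < t) (ht : t ≤ T) (h k : H) (x : Rd d) :
    valueAt (ι (U s t (h - k))) x = valueAt (ι (U s t h)) x - valueAt (ι (U s t k)) x := by
  rw [eq_sub_iff_add_eq, ← hS.valueAt_add hs hst ht, sub_add_cancel]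

/-- Smoothing is unavailable at `r = s`; this discards the null left endpoint. -/
theorem ae_Ioc_of_le {s u t : ℝ} (hsu : s ≤ u) :
    ∀ᵐ r ∂volume.restrict (Icc u t), s < r ∧ u < r ∧ r ≤ t := by
  have hne : ∀ᵐ r ∂volume.restrict (Icc u t), r ≠ u :=
    ae_restrict_of_ae (compl_mem_ae_iff.2 (measure_singleton u))
  filter_upwards [hne, ae_restrict_mem measurableSet_Icc] with r h1 h2
  have := lt_of_le_of_ne h2.1 h1.symm
  exact ⟨hsu.trans_lt this, this, h2.2⟩

/-- For a simple `f`, measurability in time holds on each fibre. Simple functions approximate `f`,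
and for fixed `r > s` smoothing makes evaluation continuous in `H`. -/
theorem aestronglyMeasurable_valueAt (hS : SmoothingCondition P F X T ι U K ν) {f : ℝ → H}
    (hf : StronglyMeasurable f) {s : ℝ} (hs : 0 ≤ s) (x : Rd d) :
    AEStronglyMeasurable (fun r => valueAt (ι (U s r (f r))) x) (volume.restrict (Icc s T)) := by
  refine aestronglyMeasurable_of_tendsto_ae atTop
    (f := fun n r => valueAt (ι (U s r (hf.approx n r))) x) (fun n => ?_) ?_
  · have e : (fun r => valueAt (ι (U s r (hf.approx n r))) x) =
        fun r => ∑ h ∈ (hf.approx n).range,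
          ((hf.approx n) ⁻¹' {h}).indicator (fun r => valueAt (ι (U s r h)) x) r := by
      funext r
      rw [Finset.sum_eq_single (hf.approx n r)]
      · rw [indicator_of_mem (by simp)]
      · intro h _ hne
        exact indicator_of_notMem (fun hr => hne (by simpa using hr.symm)) _
      · intro h
        exact absurd (SimpleFunc.mem_range_self _ r) h
    rw [e]
    refine Finset.aestronglyMeasurable_fun_sum _ fun h _ => ?_
    exact (hS.measurable_time s x h hs).aemeasurable.aestronglyMeasurable.indicator
      (SimpleFunc.measurableSet_fiber _ h)
  · filter_upwards [ae_Ioc_of_le (le_refl s)] with r hr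
    rw [tendsto_iff_norm_sub_tendsto_zero]
    have h0 : Tendsto (fun n => K * ‖hf.approx n r - f r‖ * |r - s| ^ (ν / 2)) atTop (𝓝 0) := by
      have := tendsto_iff_norm_sub_tendsto_zero.1 (hf.tendsto_approx r)
      simpa using (this.const_mul K).mul_const (|r - s| ^ (ν / 2))
    refine squeeze_zero (fun _ => norm_nonneg _) (fun n => ?_) h0
    rw [← hS.valueAt_sub hs hr.1 hr.2.2]
    exact hS.abs_valueAt_le hs hr.1 hr.2.2 _ _

end SmoothingCondition

variable {q : ℝ≥0∞}

theorem restrict_Icc_of_subset {s t : ℝ} (hs : 0 ≤ s) (ht : t ≤ T) :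
    (volume.restrict (Icc (0 : ℝ) T)).restrict (Icc s t) = volume.restrict (Icc s t) := by
  rw [Measure.restrict_restrict measurableSet_Icc, inter_eq_left.2 (Icc_subset_Icc hs ht)]

omit [NormedSpace ℝ H] in
theorem eLpNorm_eq_ofReal_localNorm (f : BochnerLp H q T) {s t : ℝ} (hs : 0 ≤ s) (ht : t ≤ T) :
    eLpNorm f q (volume.restrict (Icc s t)) = ENNReal.ofReal (localNorm f s t) := by
  rw [localNorm, eLpNorm_indicator_eq_eLpNorm_restrict measurableSet_Icc,
    restrict_Icc_of_subset hs ht, ENNReal.ofReal_toReal]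
  refine ((eLpNorm_mono_measure f ?_).trans_lt (Lp.eLpNorm_lt_top f)).ne
  exact Measure.restrict_mono (Icc_subset_Icc hs ht) le_rfl

omit [NormedSpace ℝ H] in
theorem localNorm_nonneg (f : BochnerLp H q T) (s t : ℝ) : 0 ≤ localNorm f s t :=
  ENNReal.toReal_nonneg

omit [NormedSpace ℝ H] in
theorem localNorm_mono (f : BochnerLp H q T) {s t u v : ℝ} (hs : 0 ≤ s) (hsu : s ≤ u)
    (hvt : v ≤ t) (ht : t ≤ T) : localNorm f u v ≤ localNorm f s t := by
  rw [← ENNReal.ofReal_le_ofReal_iff (localNorm_nonneg f s t),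
    ← eLpNorm_eq_ofReal_localNorm f (hs.trans hsu) (hvt.trans ht),
    ← eLpNorm_eq_ofReal_localNorm f hs ht]
  exact eLpNorm_mono_measure _ (Measure.restrict_mono (Icc_subset_Icc hsu hvt) le_rfl)

omit [NormedSpace ℝ H] in
/-- Hölder's inequality in time, against the singular weight. -/
theorem integrable_norm_mul_weight (hq : 2 < q) {γ Γ : ℝ} (hΓ : 0 ≤ Γ)
    (hW : ∀ s t : ℝ, s ≤ t →
      eLpNorm (fun r : ℝ => |r - s| ^ (ν / 2)) (ENNReal.ofReal (dualExponent q))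
        (volume.restrict (Icc s t)) ≤ ENNReal.ofReal (Γ * (t - s) ^ γ))
    (f : BochnerLp H q T) {s t : ℝ} (hs : 0 ≤ s) (hst : s ≤ t) (ht : t ≤ T) :
    IntegrableOn (fun r => ‖f r‖ * |r - s| ^ (ν / 2)) (Icc s t) ∧
      ∫ r in Icc s t, ‖f r‖ * |r - s| ^ (ν / 2) ≤ Γ * localNorm f s t * (t - s) ^ γ := by
  have := holderTriple_dualExponent hq
  have hd : 0 ≤ t - s := sub_nonneg.2 hst
  have hφ : AEStronglyMeasurable (fun r : ℝ => |r - s| ^ (ν / 2)) (volume.restrict (Icc s t)) := by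
    have : Measurable (fun r : ℝ => |r - s| ^ (ν / 2)) := by fun_prop
    exact this.aestronglyMeasurable
  have hf : AEStronglyMeasurable (fun r => ‖f r‖) (volume.restrict (Icc s t)) :=
    (Lp.stronglyMeasurable f).norm.aestronglyMeasurable
  have hle := eLpNorm_smul_le_mul_eLpNorm (r := 1) (q := q) hf hφ
    (p := ENNReal.ofReal (dualExponent q))
  rw [eLpNorm_norm, eLpNorm_eq_ofReal_localNorm f hs ht] at hle
  have hle' : eLpNorm (fun r => ‖f r‖ * |r - s| ^ (ν / 2)) 1 (volume.restrict (Icc s t)) ≤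
      ENNReal.ofReal (Γ * localNorm f s t * (t - s) ^ γ) := by
    calc _ = eLpNorm ((fun r : ℝ => |r - s| ^ (ν / 2)) • fun r => ‖f r‖) 1
            (volume.restrict (Icc s t)) := by
          congr 1; funext r; simp [mul_comm]
      _ ≤ ENNReal.ofReal (Γ * (t - s) ^ γ) * ENNReal.ofReal (localNorm f s t) :=
          hle.trans (mul_le_mul_left (hW s t hst) _)
      _ = _ := by rw [← ENNReal.ofReal_mul (by positivity)]; congr 1; ring
  have hm : AEStronglyMeasurable (fun r => ‖f r‖ * |r - s| ^ (ν / 2))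
      (volume.restrict (Icc s t)) := hf.mul hφ
  refine ⟨memLp_one_iff_integrable.1 ⟨hm, hle'.trans_lt ENNReal.ofReal_lt_top⟩, ?_⟩
  rw [integral_eq_lintegral_of_nonneg_ae (Eventually.of_forall fun r => by positivity) hm]
  refine ENNReal.toReal_le_of_le_ofReal
    (mul_nonneg (mul_nonneg hΓ (localNorm_nonneg f s t)) (by positivity)) ?_
  refine le_trans (le_of_eq ?_) hle'
  rw [eLpNorm_one_eq_lintegral_enorm]
  refine lintegral_congr fun r => ?_
  rw [← ofReal_norm, Real.norm_of_nonneg (by positivity)]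

namespace SmoothingCondition

variable {f : BochnerLp H q T} {s u t : ℝ}

/-- The integrand `r ↦ U_{s,r} f_r (x)` on `[u, t]`, for `s ≤ u`. -/
theorem integrand_measurable (hS : SmoothingCondition P F X T ι U K ν) (f : BochnerLp H q T)
    (hs : 0 ≤ s) (hsu : s ≤ u) (ht : t ≤ T) (x : Rd d) :
    AEStronglyMeasurable (fun r => valueAt (ι (U s r (f r))) x) (volume.restrict (Icc u t)) :=
  (hS.aestronglyMeasurable_valueAt (Lp.stronglyMeasurable f) hs x).mono_measure
    (Measure.restrict_mono (Icc_subset_Icc hsu ht) le_rfl)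

theorem integrand_bound (hS : SmoothingCondition P F X T ι U K ν) (f : BochnerLp H q T)
    (hs : 0 ≤ s) (hsu : s ≤ u) (ht : t ≤ T) :
    ∀ᵐ r ∂volume.restrict (Icc u t), ∀ x,
      |valueAt (ι (U s r (f r))) x| ≤ K * (‖f r‖ * |r - s| ^ (ν / 2)) := by
  filter_upwards [ae_Ioc_of_le hsu] with r hr x
  rw [← mul_assoc]
  exact hS.abs_valueAt_le hs hr.1 (hr.2.2.trans ht) _ _

theorem integrand_continuous (hS : SmoothingCondition P F X T ι U K ν) (f : BochnerLp H q T)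
    (hs : 0 ≤ s) (hsu : s ≤ u) (ht : t ≤ T) :
    ∀ᵐ r ∂volume.restrict (Icc u t), Continuous (valueAt (ι (U s r (f r)))) := by
  filter_upwards [ae_Ioc_of_le hsu] with r hr
  exact hS.continuous_valueAt hs hr.1 (hr.2.2.trans ht) _

theorem integrableOn_integrand (hS : SmoothingCondition P F X T ι U K ν)
    (hs : 0 ≤ s) (ht : t ≤ T)
    (hb : IntegrableOn (fun r => ‖f r‖ * |r - s| ^ (ν / 2)) (Icc s t)) (x : Rd d) :
    IntegrableOn (fun r => valueAt (ι (U s r (f r))) x) (Icc s t) :=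
  (hb.const_mul K).mono' (hS.integrand_measurable f hs le_rfl ht x)
    ((hS.integrand_bound f hs le_rfl ht).mono fun _ hr => hr x)

/-- Dominated convergence, by a bound uniform in `x`. It makes the germ a continuous function of `X
s`, hence `F s`-measurable. -/
theorem continuous_integral (hS : SmoothingCondition P F X T ι U K ν)
    (hs : 0 ≤ s) (ht : t ≤ T)
    (hb : IntegrableOn (fun r => ‖f r‖ * |r - s| ^ (ν / 2)) (Icc s t)) :
    Continuous fun x => ∫ r in Icc s t, valueAt (ι (U s r (f r))) x :=
  continuous_of_dominated (fun x => hS.integrand_measurable f hs le_rfl ht x)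
    (fun x => (hS.integrand_bound f hs le_rfl ht).mono fun _ hr => hr x) (hb.const_mul K)
    (hS.integrand_continuous f hs le_rfl ht)

theorem measurable_germ (hS : SmoothingCondition P F X T ι U K ν)
    (hX : IsMarkovProcess P F X) (hs : 0 ≤ s) (ht : t ≤ T)
    (hb : IntegrableOn (fun r => ‖f r‖ * |r - s| ^ (ν / 2)) (Icc s t)) :
    Measurable[F s] (germ X ι U f s t) :=
  (hS.continuous_integral hs ht hb).measurable.comp (hX.adapted s hs)

theorem abs_germ_le (hS : SmoothingCondition P F X T ι U K ν) (hs : 0 ≤ s) (ht : t ≤ T)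
    (hb : IntegrableOn (fun r => ‖f r‖ * |r - s| ^ (ν / 2)) (Icc s t)) (ω : Ω) :
    |germ X ι U f s t ω| ≤ K * ∫ r in Icc s t, ‖f r‖ * |r - s| ^ (ν / 2) := by
  rw [← integral_const_mul, ← Real.norm_eq_abs, germ]
  exact norm_integral_le_of_norm_le (hb.const_mul K)
    ((hS.integrand_bound f hs le_rfl ht).mono fun _ hr => hr (X s ω))

theorem memLp_germ [IsFiniteMeasure P] (hS : SmoothingCondition P F X T ι U K ν)
    (hX : IsMarkovProcess P F X) (hs : 0 ≤ s) (ht : t ≤ T)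
    (hb : IntegrableOn (fun r => ‖f r‖ * |r - s| ^ (ν / 2)) (Icc s t)) (m : ℝ≥0∞) :
    MemLp (germ X ι U f s t) m P :=
  MemLp.of_bound (((hS.measurable_germ hX hs ht hb).mono (F.le s) le_rfl).aestronglyMeasurable) _
    (Eventually.of_forall fun ω => hS.abs_germ_le hs ht hb ω)

/-- The defect of additivity of the germ is centred. -/
theorem setIntegral_germ_defect [IsFiniteMeasure P] (hS : SmoothingCondition P F X T ι U K ν)
    (hX : IsMarkovProcess P F X) (hs : 0 ≤ s) (hsu : s ≤ u) (hut : u ≤ t) (ht : t ≤ T)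
    (hb : ∀ s t : ℝ, 0 ≤ s → s ≤ t → t ≤ T →
      IntegrableOn (fun r => ‖f r‖ * |r - s| ^ (ν / 2)) (Icc s t))
    {B : Set Ω} (hB : MeasurableSet[F s] B) :
    ∫ ω in B, germ X ι U f s t ω ∂P =
      ∫ ω in B, germ X ι U f s u ω ∂P + ∫ ω in B, germ X ι U f u t ω ∂P := by
  have hu : 0 ≤ u := hs.trans hsu
  have hbst := hb s t hs (hsu.trans hut) ht
  have hbut := hb u t hu hut ht
  have hbsu := hb s u hs hsu (hut.trans ht)
  have hsub : Icc u t ⊆ Icc s t := Icc_subset_Icc hsu le_rfl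
  have hmeas : ∀ s, 0 ≤ s → Measurable (X s) := fun s hs => (hX.adapted s hs).mono (F.le s) le_rfl
  have hsplit : ∀ ω, germ X ι U f s t ω = germ X ι U f s u ω +
      ∫ r in Icc u t, valueAt (ι (U s r (f r))) (X s ω) := fun ω => by
    have hi := hS.integrableOn_integrand hs ht hbst (X s ω)
    simp only [germ, integral_Icc_eq_integral_Ioc]
    rw [← setIntegral_union (Ioc_disjoint_Ioc_of_le le_rfl) measurableSet_Ioc
      (hi.mono_set (Ioc_subset_Icc_self.trans (Icc_subset_Icc le_rfl hut)))
      (hi.mono_set (Ioc_subset_Icc_self.trans hsub)), Ioc_union_Ioc_eq_Ioc hsu hut]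
  have hint : ∀ s t, 0 ≤ s → s ≤ t → t ≤ T →
      Integrable (germ X ι U f s t) P := fun s t hs hst ht =>
    memLp_one_iff_integrable.1 (hS.memLp_germ hX hs ht (hb s t hs hst ht) 1)
  -- Integrability of the mixed term comes for free, as a difference of two germs.
  have hdiff : (fun ω => ∫ r in Icc u t, valueAt (ι (U s r (f r))) (X s ω)) =
      germ X ι U f s t - germ X ι U f s u := by
    funext ω
    rw [Pi.sub_apply, hsplit ω, add_sub_cancel_left]
  have hint' : Integrable (fun ω => ∫ r in Icc u t, valueAt (ι (U s r (f r))) (X s ω)) P := by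
    rw [hdiff]
    exact (hint s t hs (hsu.trans hut) ht).sub (hint s u hs hsu (hut.trans ht))
  simp_rw [hsplit]
  rw [integral_add (hint s u hs hsu (hut.trans ht)).integrableOn hint'.integrableOn]
  congr 1
  simp only [germ]
  -- The null set in the transition identity depends on `r`; after exchanging integrals the identity
  -- is needed only for one `r` at a time, integrated over `B`.
  rw [integral_integral_swap_caratheodory (v := fun r => valueAt (ι (U s r (f r))))
      (hS.integrand_continuous f hs hsu ht) (hS.integrand_measurable f hs hsu ht)
      ((hbst.mono_set hsub).const_mul K) (hS.integrand_bound f hs hsu ht) (hmeas s hs),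
    integral_integral_swap_caratheodory (v := fun r => valueAt (ι (U u r (f r))))
      (hS.integrand_continuous f hu le_rfl ht) (hS.integrand_measurable f hu le_rfl ht)
      (hbut.const_mul K) (hS.integrand_bound f hu le_rfl ht) (hmeas u hu)]
  refine integral_congr_ae ?_
  filter_upwards [ae_Ioc_of_le hsu] with r hr
  have htr := hS.transition s u r (f r) hs hsu hr.2.1 (hr.2.2.trans ht)
  have hi : Integrable (fun ω => valueAt (ι (U u r (f r))) (X u ω)) P := by
    refine Integrable.of_bound (C := K * ‖f r‖ * |r - u| ^ (ν / 2)) ?_ ?_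
    · exact ((hS.continuous_valueAt hu hr.2.1 (hr.2.2.trans ht) (f r)).measurable.comp
        (hmeas u hu)).aestronglyMeasurable
    · exact Eventually.of_forall fun ω => hS.abs_valueAt_le hu hr.2.1 (hr.2.2.trans ht) _ _
  rw [← setIntegral_condExp (F.le s) hi hB]
  exact (setIntegral_congr_ae (F.le s B hB) (htr.mono fun ω h _ => h)).symm

theorem germ_add (hS : SmoothingCondition P F X T ι U K ν) {f g : BochnerLp H q T}
    (hs : 0 ≤ s) (ht : t ≤ T)
    (hf : IntegrableOn (fun r => ‖f r‖ * |r - s| ^ (ν / 2)) (Icc s t))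
    (hg : IntegrableOn (fun r => ‖g r‖ * |r - s| ^ (ν / 2)) (Icc s t)) (ω : Ω) :
    germ X ι U (f + g) s t ω = germ X ι U f s t ω + germ X ι U g s t ω := by
  simp only [germ]
  rw [← integral_add (hS.integrableOn_integrand hs ht hf _)
    (hS.integrableOn_integrand hs ht hg _)]
  have hae : ∀ᵐ r ∂volume.restrict (Icc s t), (f + g : BochnerLp H q T) r = f r + g r := by
    rw [← restrict_Icc_of_subset hs ht]
    exact ae_restrict_of_ae (Lp.coeFn_add f g)
  refine integral_congr_ae ?_
  filter_upwards [hae, ae_Ioc_of_le (le_refl s)] with r h hr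
  rw [h, hS.valueAt_add hs hr.1 (hr.2.2.trans ht)]

theorem germ_smul (hS : SmoothingCondition P F X T ι U K ν) (c : ℝ) (f : BochnerLp H q T)
    (hs : 0 ≤ s) (ht : t ≤ T) (ω : Ω) :
    germ X ι U (c • f) s t ω = c * germ X ι U f s t ω := by
  simp only [germ]
  rw [← integral_const_mul]
  have hae : ∀ᵐ r ∂volume.restrict (Icc s t), (c • f : BochnerLp H q T) r = c • f r := by
    rw [← restrict_Icc_of_subset hs ht]
    exact ae_restrict_of_ae (Lp.coeFn_smul c f)
  refine integral_congr_ae ?_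
  filter_upwards [hae, ae_Ioc_of_le (le_refl s)] with r h hr
  rw [h, hS.valueAt_smul hs hr.1 (hr.2.2.trans ht)]

end SmoothingCondition

end Germ

/-! ### The germ as a sewing germ in `L^m` -/

section RegularizedIntegral

open Filter Topology

/-- With all null sets in `G`, a modification on a null set stays `G`-measurable, so any
representative of an `L^m` class will do. -/
theorem measurable_of_aestronglyMeasurable {Ω : Type*} {G mΩ : MeasurableSpace Ω} {P : Measure Ω}
    (hG : ∀ N : Set Ω, P N = 0 → MeasurableSet[G] N) {f : Ω → ℝ}
    (hf : AEStronglyMeasurable[G] f P) : Measurable[G] f := by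
  obtain ⟨g, hg, hfg⟩ := hf
  have hnull : P {ω | f ω ≠ g ω} = 0 := hfg
  intro B hB
  have e : f ⁻¹' B = (g ⁻¹' B ∩ {ω | f ω ≠ g ω}ᶜ) ∪ (f ⁻¹' B ∩ {ω | f ω ≠ g ω}) := by
    ext ω
    by_cases h : f ω = g ω <;> simp [h]
  rw [e]
  exact ((hg.measurable hB).inter (hG _ hnull).compl).union
    (hG _ (measure_mono_null inter_subset_right hnull))

theorem martingaleScale_Lp {Ω : Type*} {mΩ : MeasurableSpace Ω} (P : Measure Ω)
    [IsProbabilityMeasure P] (F : Filtration ℝ mΩ) {m : ℝ≥0∞} [Fact (1 ≤ m)] {c : ℝ} (hc : 0 ≤ c)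
    (h : ∀ t, ∀ f ∈ lpMeas ℝ ℝ (F t) m P, ∀ g ∈ condNull P m (F t),
      ‖f + g‖ ^ 2 ≤ ‖f‖ ^ 2 + c * ‖g‖ ^ 2) :
    MartingaleScale (fun t => lpMeas ℝ ℝ (F t) m P) (fun t => condNull P m (F t)) c where
  nonneg := hc
  mono _ _ hst _ hf := mem_lpMeas_iff_aestronglyMeasurable.2
    ((mem_lpMeas_iff_aestronglyMeasurable.1 hf).mono (F.mono hst))
  anti _ _ hst := condNull_anti (F.mono hst)
  isClosed_adapted t := isClosed_aestronglyMeasurable (F.le t)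
  isClosed_centred t := isClosed_condNull (F t)
  norm_add_sq_le := h

variable {d : ℕ} {Ω : Type*} {mΩ : MeasurableSpace Ω} {P : Measure Ω}
  {F : Filtration ℝ mΩ} {X : ℝ → Ω → Rd d} {T : ℝ} {H : Type*} [NormedAddCommGroup H]
  [NormedSpace ℝ H] {ι : H →ₗ[ℝ] RealTemperedDistribution d} {U : ℝ → ℝ → H →L[ℝ] H} {K ν : ℝ}
  {q : ℝ≥0∞}

open Classical in
/-- The germ as an element of `L^m`. -/
noncomputable def germLp (P : Measure Ω) (m : ℝ≥0∞) (X : ℝ → Ω → Rd d)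
    (ι : H →ₗ[ℝ] RealTemperedDistribution d) (U : ℝ → ℝ → H →L[ℝ] H)
    (f : BochnerLp H q T) (s t : ℝ) : Lp ℝ m P :=
  -- The default `0` is never met in the range `0 ≤ s ≤ t ≤ T`, where the germ is bounded.
  if h : MemLp (germ X ι U f s t) m P then h.toLp _ else 0

theorem coeFn_germLp {m : ℝ≥0∞} {f : BochnerLp H q T} {s t : ℝ}
    (h : MemLp (germ X ι U f s t) m P) : germLp P m X ι U f s t =ᵐ[P] germ X ι U f s t := by
  rw [germLp, dif_pos h]
  exact h.coeFn_toLp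

variable {m : ℝ≥0∞} [Fact (1 ≤ m)] [IsProbabilityMeasure P]

/-- The control is the local norm of `f` on the whole of `[s,t]`, which dominates the one on each
subinterval. It need not be additive in the interval. -/
theorem SmoothingCondition.isSewingGerm (hS : SmoothingCondition P F X T ι U K ν)
    (hX : IsMarkovProcess P F X) (hK : 0 ≤ K) {Γ γ : ℝ} (hΓ : 0 ≤ Γ)
    (hb : ∀ (f : BochnerLp H q T) (s t : ℝ), 0 ≤ s → s ≤ t → t ≤ T →
      IntegrableOn (fun r => ‖f r‖ * |r - s| ^ (ν / 2)) (Icc s t) ∧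
      ∫ r in Icc s t, ‖f r‖ * |r - s| ^ (ν / 2) ≤ Γ * localNorm f s t * (t - s) ^ γ)
    (f : BochnerLp H q T) {s t : ℝ} (hs : 0 ≤ s) (ht : t ≤ T) :
    IsSewingGerm (fun t => lpMeas ℝ ℝ (F t) m P) (fun t => condNull P m (F t))
      (germLp P m X ι U f) s t (K * Γ * localNorm f s t) γ := by
  have hmem : ∀ u v, 0 ≤ u → u ≤ v → v ≤ T → MemLp (germ X ι U f u v) m P :=
    fun u v hu huv hv => hS.memLp_germ hX hu hv (hb f u v hu huv hv).1 m
  refine ⟨mul_nonneg (mul_nonneg hK hΓ) (localNorm_nonneg f s t), fun u v hu huv hv => ?_,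
    fun u v hu huv hv => ?_, fun u v w hu huv hvw hw => ?_⟩
  · refine mem_lpMeas_iff_aestronglyMeasurable.2 ⟨germ X ι U f u v, ?_,
      coeFn_germLp (hmem u v (hs.trans hu) huv (hv.trans ht))⟩
    exact (hS.measurable_germ hX (hs.trans hu) (hv.trans ht)
      (hb f u v (hs.trans hu) huv (hv.trans ht)).1).stronglyMeasurable
  · have hu' := hs.trans hu
    have hv' := hv.trans ht
    obtain ⟨h1, h2⟩ := hb f u v hu' huv hv'
    have hd : 0 ≤ v - u := sub_nonneg.2 huv
    have hB : K * ∫ r in Icc u v, ‖f r‖ * |r - u| ^ (ν / 2) ≤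
        K * Γ * localNorm f s t * (v - u) ^ γ := by
      calc _ ≤ K * (Γ * localNorm f u v * (v - u) ^ γ) := mul_le_mul_of_nonneg_left h2 hK
        _ ≤ K * (Γ * localNorm f s t * (v - u) ^ γ) := by
          have := localNorm_mono f hs hu hv ht
          gcongr
        _ = _ := by ring
    have h0 : 0 ≤ K * Γ * localNorm f s t * (v - u) ^ γ :=
      mul_nonneg (mul_nonneg (mul_nonneg hK hΓ) (localNorm_nonneg f s t)) (by positivity)
    have := Lp.norm_le_of_ae_bound (f := germLp P m X ι U f u v) h0
      ((coeFn_germLp (hmem u v hu' huv hv')).mono fun ω h => by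
        rw [h]; exact (hS.abs_germ_le hu' hv' h1 ω).trans hB)
    simpa [measureUnivNNReal] using this
  · have hu' := hs.trans hu
    have hw' := hw.trans ht
    intro B hB
    have hi1 := hmem u w hu' (huv.trans hvw) hw'
    have hi2 := hmem u v hu' huv (hvw.trans hw')
    have hi3 := hmem v w (hu'.trans huv) hvw hw'
    have hae : (germLp P m X ι U f u w - germLp P m X ι U f u v - germLp P m X ι U f v w :
        Lp ℝ m P) =ᵐ[P] fun ω => germ X ι U f u w ω - germ X ι U f u v ω - germ X ι U f v w ω := by
      filter_upwards [Lp.coeFn_sub (germLp P m X ι U f u w - germLp P m X ι U f u v)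
        (germLp P m X ι U f v w), Lp.coeFn_sub (germLp P m X ι U f u w) (germLp P m X ι U f u v),
        coeFn_germLp hi1, coeFn_germLp hi2, coeFn_germLp hi3] with ω e1 e2 e3 e4 e5
      rw [e1, Pi.sub_apply, e2, Pi.sub_apply, e3, e4, e5]
    have hm1 : (1 : ℝ≥0∞) ≤ m := Fact.out
    have i1 := (hi1.integrable hm1).integrableOn (s := B)
    have i2 := (hi2.integrable hm1).integrableOn (s := B)
    have i3 := (hi3.integrable hm1).integrableOn (s := B)
    rw [integral_congr_ae (ae_restrict_of_ae hae),
      integral_sub (f := fun ω => germ X ι U f u w ω - germ X ι U f u v ω) (i1.sub i2) i3,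
      integral_sub i1 i2,
      hS.setIntegral_germ_defect hX hu' huv hvw hw' (fun s t hs hst ht => (hb f s t hs hst ht).1) hB]
    ring

omit [Fact (1 ≤ m)] in
theorem germLp_add (hS : SmoothingCondition P F X T ι U K ν) (hX : IsMarkovProcess P F X)
    (hb : ∀ (f : BochnerLp H q T) (s t : ℝ), 0 ≤ s → s ≤ t → t ≤ T →
      IntegrableOn (fun r => ‖f r‖ * |r - s| ^ (ν / 2)) (Icc s t))
    (f g : BochnerLp H q T) {s t : ℝ} (hs : 0 ≤ s) (hst : s ≤ t) (ht : t ≤ T) :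
    germLp P m X ι U (f + g) s t = germLp P m X ι U f s t + germLp P m X ι U g s t := by
  refine Lp.ext ?_
  filter_upwards [Lp.coeFn_add (germLp P m X ι U f s t) (germLp P m X ι U g s t),
    coeFn_germLp (hS.memLp_germ hX hs ht (hb f s t hs hst ht) m),
    coeFn_germLp (hS.memLp_germ hX hs ht (hb g s t hs hst ht) m),
    coeFn_germLp (hS.memLp_germ hX hs ht (hb (f + g) s t hs hst ht) m)] with ω e1 e2 e3 e4
  rw [e1, Pi.add_apply, e2, e3, e4,
    hS.germ_add hs ht (hb f s t hs hst ht) (hb g s t hs hst ht)]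

omit [Fact (1 ≤ m)] in
theorem germLp_smul (hS : SmoothingCondition P F X T ι U K ν) (hX : IsMarkovProcess P F X)
    (hb : ∀ (f : BochnerLp H q T) (s t : ℝ), 0 ≤ s → s ≤ t → t ≤ T →
      IntegrableOn (fun r => ‖f r‖ * |r - s| ^ (ν / 2)) (Icc s t))
    (c : ℝ) (f : BochnerLp H q T) {s t : ℝ} (hs : 0 ≤ s) (hst : s ≤ t) (ht : t ≤ T) :
    germLp P m X ι U (c • f) s t = c • germLp P m X ι U f s t := by
  refine Lp.ext ?_
  filter_upwards [Lp.coeFn_smul c (germLp P m X ι U f s t),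
    coeFn_germLp (hS.memLp_germ hX hs ht (hb f s t hs hst ht) m),
    coeFn_germLp (hS.memLp_germ hX hs ht (hb (c • f) s t hs hst ht) m)] with ω e1 e2 e3
  rw [e1, Pi.smul_apply, e2, e3, hS.germ_smul c f hs ht, smul_eq_mul]

end RegularizedIntegral

/-! ### Construction of the additive functional -/

theorem proposition3p4 (m q : ℝ≥0∞) [Fact (1 ≤ m)] (hm : 2 ≤ m) (hm_top : m ≠ ∞)
    (ν : ℝ) (hν : ν ≤ 0) (hq : 2 < q) (hνq : ν / 2 - (1 / q).toReal > -(1 / 2)) :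
    ∃ C : ℝ, 0 ≤ C ∧
      ∀ (d : ℕ) (T : ℝ), 0 < T →
      ∀ (Ω : Type*) (mΩ : MeasurableSpace Ω) (P : Measure Ω) [IsProbabilityMeasure P]
        (F : Filtration ℝ mΩ), (∀ N : Set Ω, P N = 0 → MeasurableSet[F 0] N) →
      ∀ X : ℝ → Ω → Rd d, IsMarkovProcess P F X →
      ∀ (H : Type*) [NormedAddCommGroup H] [NormedSpace ℝ H]
        (ι : H →ₗ[ℝ] RealTemperedDistribution d), IsDistributionSpace ι →
      ∀ (U : ℝ → ℝ → H →L[ℝ] H) (K : ℝ), 0 ≤ K → SmoothingCondition P F X T ι U K ν →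
      -- the integrals over `[s,t]` exist and define elements of `L_m`
      (∀ (f : BochnerLp H q T) (s t : ℝ), 0 ≤ s → s ≤ t → t ≤ T →
        (∀ x : Rd d, IntegrableOn (fun r => valueAt (ι (U s r (f r))) x) (Icc s t)) ∧
        MemLp (germ X ι U f s t) m P) ∧
      ∃ A : BochnerLp H q T →ₗ[ℝ] holderSpace P m T (1 + ν / 2 - (1 / q).toReal),
        (∀ (f : BochnerLp H q T) (t : Icc (0 : ℝ) T), Measurable[F t] ((A f).1 t : Ω → ℝ)) ∧
        (∀ (f : BochnerLp H q T) (s t : Icc (0 : ℝ) T), s ≤ t →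
          P[((A f).1 t - (A f).1 s : Lp ℝ m P) | F s] =ᵐ[P] germ X ι U f s t) ∧
        (∀ (f : BochnerLp H q T) (s t : Icc (0 : ℝ) T), s ≤ t →
          ‖(A f).1 t - (A f).1 s‖ ≤
            C * K * localNorm f s t * |(t : ℝ) - s| ^ (1 + ν / 2 - (1 / q).toReal)) ∧
        (∀ (f : BochnerLp H q T) (t : Icc (0 : ℝ) T), ∀ ε : ℝ, 0 < ε → ∃ δ : ℝ, 0 < δ ∧
          ∀ (n : ℕ) (p : Fin (n + 1) → ℝ), StrictMono p → p 0 = 0 → p (Fin.last n) = t →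
            (∀ i : Fin n, p i.succ - p i.castSucc < δ) →
            eLpNorm (fun ω => (A f).1 t ω - ∑ i : Fin n, germ X ι U f (p i.castSucc) (p i.succ) ω)
              m P < ENNReal.ofReal ε) := by
  -- Both `c` and `Γ` are fixed before the probability space, the process and `H` appear, so the
  -- final constant depends on `m`, `ν`, `q` only.
  obtain ⟨c, hc, hc2⟩ := exists_norm_add_sq_le hm_top hm
  obtain ⟨Γ, hΓ, hW⟩ := exists_eLpNorm_weight_le hq hνq
  have hγ : 1 / 2 < 1 + ν / 2 - (1 / q).toReal := by linarith
  set γ := 1 + ν / 2 - (1 / q).toReal with hγdef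
  have hκ : 0 < γ - 1 / 2 := sub_pos.2 hγ
  set L := 3 * √c / (1 - (1 / 2 : ℝ) ^ (γ - 1 / 2)) with hL
  have hL0 : 0 ≤ L := div_nonneg (by positivity)
    (sub_nonneg.2 (MartingaleScale.half_rpow_lt_one hκ).le)
  -- An increment is germ plus remainder: the germ contributes `1`, the sewing remainder `L`.
  refine ⟨(1 + L) * Γ, by positivity, ?_⟩
  intro d T hT Ω mΩ P _ F hF X hX H _ _ ι _ U K hK hS
  have hb := fun (f : BochnerLp H q T) (s t : ℝ) (hs : 0 ≤ s) (hst : s ≤ t) (ht : t ≤ T) =>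
    integrable_norm_mul_weight hq hΓ hW f hs hst ht
  have hmem := fun (f : BochnerLp H q T) (s t : ℝ) (hs : 0 ≤ s) (hst : s ≤ t) (ht : t ≤ T) =>
    hS.memLp_germ hX hs ht (hb f s t hs hst ht).1 m
  refine ⟨fun f s t hs hst ht => ⟨hS.integrableOn_integrand hs ht (hb f s t hs hst ht).1,
    hmem f s t hs hst ht⟩, ?_⟩
  have hM := martingaleScale_Lp P F hc fun t => hc2 Ω (F t) mΩ P (F.le t)
  have hgerm := fun (f : BochnerLp H q T) (s t : ℝ) (hs : 0 ≤ s) (_ : s ≤ t) (ht : t ≤ T) =>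
    hS.isSewingGerm (m := m) hX hK hΓ hb f hs ht
  choose I hI0 hIV hI using fun f => hM.exists_sewing hT.le hγ (hgerm f)
  have hW0 : ∀ f : BochnerLp H q T, 0 ≤ L * (K * Γ * localNorm f 0 T) := fun f =>
    mul_nonneg hL0 (mul_nonneg (mul_nonneg hK hΓ) (localNorm_nonneg f 0 T))
  have hIW : ∀ (f : BochnerLp H q T) (u v : ℝ), 0 ≤ u → u ≤ v → v ≤ T →
      ‖I f v - I f u - germLp P m X ι U f u v‖ ≤
        L * (K * Γ * localNorm f 0 T) * (v - u) ^ γ := fun f u v hu huv hv => by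
    have hd : 0 ≤ v - u := sub_nonneg.2 huv
    have hloc := localNorm_mono f le_rfl hu hv le_rfl
    refine (hI f u v hu huv hv).2.trans ?_
    gcongr
  -- The paths `I f` are chosen separately for each `f`; linearity is recovered from this
  -- description as a limit of sums linear in `f`.
  have hlim := fun (f : BochnerLp H q T) (t : ℝ) (ht0 : 0 ≤ t) (htT : t ≤ T) =>
    hM.tendsto_riemannSum (hIV f)
      (fun u v hu huv hv => (hgerm f u v hu huv hv).mem u v le_rfl huv le_rfl)
      (fun u v hu huv hv => (hI f u v hu huv hv).1) (hW0 f) hγ (hIW f) le_rfl ht0 htT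
  simp only [hI0, sub_zero] at hlim
  have hincr : ∀ (f : BochnerLp H q T) (s t : ℝ), 0 ≤ s → s ≤ t → t ≤ T →
      ‖I f t - I f s‖ ≤ (1 + L) * Γ * K * localNorm f s t * |t - s| ^ γ := by
    intro f s t hs hst ht
    have h1 := (hI f s t hs hst ht).2
    have h2 := (hgerm f s t hs hst ht).norm_le s t le_rfl hst le_rfl
    have h3 := norm_add_le (I f t - I f s - germLp P m X ι U f s t) (germLp P m X ι U f s t)
    rw [sub_add_cancel] at h3
    rw [abs_of_nonneg (sub_nonneg.2 hst)]
    linarith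
  have hincr' : ∀ (f : BochnerLp H q T) (s t : ℝ), 0 ≤ s → s ≤ t → t ≤ T →
      ‖I f t - I f s‖ ≤ (1 + L) * Γ * K * localNorm f 0 T * |t - s| ^ γ := by
    intro f s t hs hst ht
    refine (hincr f s t hs hst ht).trans ?_
    have hloc := localNorm_mono f le_rfl hs ht le_rfl
    gcongr
  have hholder : ∀ f : BochnerLp H q T, (fun t : Icc (0 : ℝ) T => I f t) ∈ holderSpace P m T γ := by
    intro f
    have hB : 0 ≤ (1 + L) * Γ * K * localNorm f 0 T :=
      mul_nonneg (by positivity) (localNorm_nonneg f 0 T)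
    refine ⟨⟨(1 + L) * Γ * K * localNorm f 0 T * T ^ γ, fun t => ?_⟩,
      ⟨(1 + L) * Γ * K * localNorm f 0 T, fun s t hst => ?_⟩⟩
    · have := hincr' f 0 t le_rfl t.2.1 t.2.2
      rw [hI0, sub_zero, sub_zero, abs_of_nonneg t.2.1] at this
      refine this.trans (mul_le_mul_of_nonneg_left ?_ hB)
      exact Real.rpow_le_rpow t.2.1 t.2.2 (by linarith)
    · refine div_le_of_le_mul₀ (by positivity) hB ?_
      rcases le_total (s : ℝ) t with h | h
      · exact hincr' f s t s.2.1 h t.2.2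
      · rw [norm_sub_rev, abs_sub_comm]
        exact hincr' f t s t.2.1 h s.2.2
  have hpart : ∀ (t : ℝ), 0 ≤ t → t ≤ T → ∀ n : ℕ, ∀ i ∈ Finset.range (2 ^ n),
      0 ≤ 0 + (i : ℝ) * (t / 2 ^ n) ∧
      0 + (i : ℝ) * (t / 2 ^ n) ≤ 0 + ((i + 1 : ℕ) : ℝ) * (t / 2 ^ n) ∧
      0 + ((i + 1 : ℕ) : ℝ) * (t / 2 ^ n) ≤ T := by
    intro t ht0 htT n i hi
    have hi' : ((i + 1 : ℕ) : ℝ) ≤ 2 ^ n := by exact_mod_cast Finset.mem_range.1 hi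
    have hp : 0 ≤ t / 2 ^ n := by positivity
    refine ⟨by positivity, by push_cast; linarith, ?_⟩
    calc 0 + ((i + 1 : ℕ) : ℝ) * (t / 2 ^ n) ≤ 0 + 2 ^ n * (t / 2 ^ n) := by gcongr
      _ = t := by field_simp; ring
      _ ≤ T := htT
  have hadd : ∀ (f g : BochnerLp H q T) (t : ℝ), 0 ≤ t → t ≤ T →
      I (f + g) t = I f t + I g t := by
    intro f g t ht0 htT
    refine tendsto_nhds_unique (hlim (f + g) t ht0 htT)
      (((hlim f t ht0 htT).add (hlim g t ht0 htT)).congr fun n => ?_)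
    rw [riemannSum, riemannSum, riemannSum, ← Finset.sum_add_distrib]
    refine Finset.sum_congr rfl fun i hi => ?_
    obtain ⟨h1, h2, h3⟩ := hpart t ht0 htT n i hi
    exact (germLp_add hS hX (fun f s t hs hst ht => (hb f s t hs hst ht).1) f g h1 h2 h3).symm
  have hsmul : ∀ (a : ℝ) (f : BochnerLp H q T) (t : ℝ), 0 ≤ t → t ≤ T →
      I (a • f) t = a • I f t := by
    intro a f t ht0 htT
    refine tendsto_nhds_unique (hlim (a • f) t ht0 htT)
      (((hlim f t ht0 htT).const_smul a).congr fun n => ?_)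
    rw [riemannSum, riemannSum, Finset.smul_sum]
    refine Finset.sum_congr rfl fun i hi => ?_
    obtain ⟨h1, h2, h3⟩ := hpart t ht0 htT n i hi
    exact (germLp_smul hS hX (fun f s t hs hst ht => (hb f s t hs hst ht).1) a f h1 h2 h3).symm
  refine ⟨{ toFun := fun f => ⟨fun t => I f t, hholder f⟩
            map_add' := fun f g => Subtype.ext (funext fun t => hadd f g t t.2.1 t.2.2)
            map_smul' := fun a f => Subtype.ext (funext fun t => hsmul a f t t.2.1 t.2.2) },
    fun f t => ?_, fun f s t hst => ?_, fun f s t hst => ?_, fun f t ε hε => ?_⟩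
  · refine measurable_of_aestronglyMeasurable (P := P)
      (fun N hN => F.mono t.2.1 N (hF N hN)) ?_
    exact mem_lpMeas_iff_aestronglyMeasurable.1 (hIV f t t.2.1 t.2.2)
  · have hst' : (s : ℝ) ≤ t := hst
    have hD := condExp_eq_zero_of_mem_condNull (F.le s) (hI f s t s.2.1 hst' t.2.2).1
    have hg := hmem f s t s.2.1 hst' t.2.2
    have hgi : Integrable (germ X ι U f s t) P := hg.integrable Fact.out
    show P[(I f t - I f s : Lp ℝ m P) | F s] =ᵐ[P] germ X ι U f s t
    -- The increment is a centred remainder plus the germ, which is already `F s`-measurable.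
    have hae : (I f t - I f s : Lp ℝ m P) =ᵐ[P]
        (I f t - I f s - germLp P m X ι U f s t : Lp ℝ m P) + germ X ι U f s t := by
      filter_upwards [Lp.coeFn_sub (I f t - I f s) (germLp P m X ι U f s t),
        coeFn_germLp hg] with ω e1 e2
      rw [Pi.add_apply, e1, Pi.sub_apply, e2, sub_add_cancel]
    have hsm : StronglyMeasurable[F s] (germ X ι U f s t) :=
      (hS.measurable_germ hX s.2.1 t.2.2 (hb f s t s.2.1 hst' t.2.2).1).stronglyMeasurable
    refine (condExp_congr_ae hae).trans ?_
    refine (condExp_add (integrable_coe_Lp _) hgi _).trans ?_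
    rw [condExp_of_stronglyMeasurable (F.le s) hsm hgi]
    filter_upwards [hD] with ω e
    rw [Pi.add_apply, e, Pi.zero_apply, zero_add]
  · exact hincr f s t s.2.1 hst t.2.2
  · set B := √c * (L * (K * Γ * localNorm f 0 T)) * √(t : ℝ) with hB
    have hB0 : 0 ≤ B := mul_nonneg (mul_nonneg (by positivity) (hW0 f)) (by positivity)
    have hεB : 0 < ε / (B + 1) := by positivity
    -- Chosen so that `B * δ ^ (γ - 1 / 2) = B ε / (B + 1) < ε`; the `+ 1` covers `B = 0`.
    refine ⟨(ε / (B + 1)) ^ (γ - 1 / 2)⁻¹, by positivity, ?_⟩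
    intro n p hp hp0 hpt hgap
    -- The partition is continued to all of `ℕ` by staying at its last point, which keeps it
    -- monotone.
    set Q : ℕ → ℝ := fun i => p ⟨min i n, by omega⟩ with hQ
    have hQm : Monotone Q := fun i j hij => hp.monotone (by
      simp only [Fin.mk_le_mk]; omega)
    have hQs : ∀ i : Fin n, Q i = p i.castSucc := fun i => by
      simp only [hQ]; congr 2; omega
    have hQs' : ∀ i : Fin n, Q (i + 1) = p i.succ := fun i => by
      simp only [hQ]; congr 2; omega
    have hQ0 : Q 0 = 0 := by rw [← hp0]; rfl
    have hQn : Q n = t := by rw [← hpt]; simp [hQ, Fin.last]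
    have hle := hM.norm_sub_riemannSum_le (hIV f)
      (fun u v hu huv hv => (hgerm f u v hu huv hv).mem u v le_rfl huv le_rfl)
      (fun u v hu huv hv => (hI f u v hu huv hv).1) (hW0 f) hγ.le (hIW f) hQm (n := n) hQ0.ge
      (hQn.le.trans t.2.2) (δ := (ε / (B + 1)) ^ (γ - 1 / 2)⁻¹) (by positivity)
      (fun i hi => by
        have := (hgap ⟨i, hi⟩).le
        rw [← hQs, ← hQs'] at this
        exact this)
    rw [hQ0, hQn, hI0, sub_zero, sub_zero, ← hB, Real.rpow_inv_rpow hεB.le hκ.ne'] at hle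
    have hlt : ‖I f t - riemannSum (germLp P m X ι U f) Q n‖ < ε := by
      refine hle.trans_lt ?_
      rw [mul_div_assoc', div_lt_iff₀ (by positivity)]
      nlinarith
    have hae : (fun ω => I f t ω - ∑ i : Fin n, germ X ι U f (p i.castSucc) (p i.succ) ω) =ᵐ[P]
        (I f t - riemannSum (germLp P m X ι U f) Q n : Lp ℝ m P) := by
      have hsum : ∀ᵐ ω ∂P, ∀ i : Fin n, germLp P m X ι U f (Q i) (Q (i + 1)) ω =
          germ X ι U f (p i.castSucc) (p i.succ) ω := by
        refine ae_all_iff.2 fun i => ?_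
        rw [← hQs, ← hQs']
        exact coeFn_germLp (hmem f _ _ (hQ0.ge.trans (hQm (Nat.zero_le _))) (hQm (Nat.le_succ _))
          ((hQm i.2).trans (hQn.le.trans t.2.2)))
      have hcoe : ⇑(riemannSum (germLp P m X ι U f) Q n) =ᵐ[P]
          ∑ i ∈ Finset.range n, ⇑(germLp P m X ι U f (Q i) (Q (i + 1))) :=
        Lp.coeFn_finsetSum _ _
      filter_upwards [Lp.coeFn_sub (I f t) (riemannSum (germLp P m X ι U f) Q n), hsum, hcoe]
        with ω e1 e2 e3
      rw [e1, Pi.sub_apply, e3, Finset.sum_apply, Finset.sum_range]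
      simp only [e2]
    show eLpNorm (fun ω => I f t ω - ∑ i : Fin n, germ X ι U f (p i.castSucc) (p i.succ) ω) m P <
      ENNReal.ofReal ε
    rw [eLpNorm_congr_ae hae, ← ENNReal.ofReal_toReal (Lp.eLpNorm_ne_top _), ← Lp.norm_def]
    exact (ENNReal.ofReal_lt_ofReal_iff hε).2 hlt
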